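/- Let $d\ge 1$ be an integer, let $1<p<\infty$ if $d\in\{1,2\}$ and $1<p<\frac{d+2}{d-2}$ if $d\ge 3$, and let $V:\mathbb R^d\to[0,\infty)$ be a measurable potential with $V(x)\to\infty$ as $|x|\to\infty$. Let $X$ be the space of all $\phi\in H^1(\mathbb R^d;\mathbb C)$ with $\int_{\mathbb R^d} V|\phi|^2\,dx<\infty$, and for $\omega\in\mathbb R$ and $\phi\in X$ put $$E(\phi)=\tfrac12\|\nabla\phi\|_{L^2}^2+\int_{\mathbb R^d}V|\phi|^2\,dx+\tfrac{2}{p+1}\|\phi\|_{L^{p+1}}^{p+1},\qquad S_\omega(\phi)=E(\phi)+\omega\|\phi\|_{L^2}^2,$$ $$\omega_0=\inf_{0\ne\phi\in X}\frac{\int_{\mathbb R^d}\left(\frac12|\nabla\phi|^2+V|\phi|^2\right)dx}{\|\phi\|_{L^2}^2}.$$ An action ground state associated with $\omega$ is a minimizer of $S_\omega$ among all nonzero weak solutions $\phi\in X$ of $$-\tfrac12\Delta\phi+V\phi+|\phi|^{p-1}\phi+\omega\phi=0,$$ where $\phi\in X$ is a weak solution if $\int_{\mathbb R^d}\left(\frac12\nabla\phi\cdot\nabla\overline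 v+V\phi\overline v+|\phi|^{p-1}\phi\overline v+\omega\phi\overline v\right)dx=0$ for all $v\in X$. An energy ground state with mass $m>0$ is a minimizer of $E$ among all $\phi\in X$ with $\|\phi\|_{L^2}^2=m$. Theorem. For every $\omega<-\omega_0$, every action ground state $\phi_\omega$ associated with $\omega$ is also an energy ground state with mass $m=\|\phi_\omega\|_{L^2}^2$. -/

import Mathlib

noncomputable section

namespace DefocusingNLS

open MeasureTheory Filter

variable {d : ℕ}

/-- `g` is the weak gradient of the complex-valued function `φ` on `ℝ^d`: for every real test
function `η ∈ C_c^∞(ℝ^d)` and every coordinate `i`, `∫ φ ∂ᵢη = -∫ gᵢ η`. (Complex test functions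
give the same notion, by linearity.) -/
def IsWeakGrad (φ : EuclideanSpace ℝ (Fin d) → ℂ)
    (g : EuclideanSpace ℝ (Fin d) → EuclideanSpace ℂ (Fin d)) : Prop :=
  LocallyIntegrable φ volume ∧ LocallyIntegrable g volume ∧
    ∀ η : EuclideanSpace ℝ (Fin d) → ℝ, ContDiff ℝ ((⊤ : ℕ∞) : WithTop ℕ∞) η → HasCompactSupport η → ∀ i : Fin d,
      ∫ x, (fderiv ℝ η x (EuclideanSpace.single i 1)) • φ x = -∫ x, η x • g x i

/-- The Sobolev space `H¹(ℝ^d; ℂ)`: `φ ∈ L²` with a weak gradient in `L²`. -/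
def MemH1 (φ : EuclideanSpace ℝ (Fin d) → ℂ) : Prop :=
  MemLp φ 2 volume ∧ ∃ g, MemLp g 2 volume ∧ IsWeakGrad φ g

open Classical in
/-- The weak gradient `∇φ` (unique up to null sets, see `IsWeakGrad.ae_eq`); `0` if `φ` has no
weak gradient. -/
def weakGrad (φ : EuclideanSpace ℝ (Fin d) → ℂ) :
    EuclideanSpace ℝ (Fin d) → EuclideanSpace ℂ (Fin d) :=
  if h : ∃ g, IsWeakGrad φ g then h.choose else 0

/-- Weak gradients are unique almost everywhere. -/
theorem IsWeakGrad.ae_eq {φ : EuclideanSpace ℝ (Fin d) → ℂ}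
    {g h : EuclideanSpace ℝ (Fin d) → EuclideanSpace ℂ (Fin d)}
    (hg : IsWeakGrad φ g) (hh : IsWeakGrad φ h) : g =ᵐ[volume] h := by
  have comp : ∀ {k : EuclideanSpace ℝ (Fin d) → EuclideanSpace ℂ (Fin d)},
      LocallyIntegrable k volume → ∀ i : Fin d, LocallyIntegrable (fun x => k x i) volume := by
    intro k hk i x
    obtain ⟨s, hs, hks⟩ := hk x
    exact ⟨s, hs, (EuclideanSpace.proj (𝕜 := ℂ) i).integrable_comp hks⟩
  have key : ∀ i : Fin d, ∀ᵐ x, g x i = h x i := by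
    intro i
    refine ae_eq_of_integral_contDiff_smul_eq (comp hg.2.1 i) (comp hh.2.1 i) ?_
    intro η hη hc
    have h1 := hg.2.2 η hη hc i
    have h2 := hh.2.2 η hη hc i
    exact neg_injective (h1.symm.trans h2)
  filter_upwards [ae_all_iff.2 key] with x hx
  ext i
  exact hx i

/-- `weakGrad φ` agrees a.e. with any weak gradient of `φ`. -/
theorem IsWeakGrad.weakGrad_ae_eq {φ : EuclideanSpace ℝ (Fin d) → ℂ}
    {g : EuclideanSpace ℝ (Fin d) → EuclideanSpace ℂ (Fin d)}
    (hg : IsWeakGrad φ g) : weakGrad φ =ᵐ[volume] g := by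
  have hex : ∃ g, IsWeakGrad φ g := ⟨g, hg⟩
  have : weakGrad φ = hex.choose := by simp only [weakGrad, dif_pos hex]
  rw [this]
  exact hex.choose_spec.ae_eq hg

/-- The space `X = H¹(ℝ^d) ∩ L²_V(ℝ^d)`. -/
def MemX (V : EuclideanSpace ℝ (Fin d) → ℝ) (φ : EuclideanSpace ℝ (Fin d) → ℂ) : Prop :=
  MemH1 φ ∧ Integrable (fun x => V x * ‖φ x‖ ^ 2) volume

/-- The functions of finite energy, i.e. `φ ∈ X` with `φ ∈ L^{p+1}(ℝ^d)`. For subcritical `p`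
the second condition is automatic (Sobolev embedding), so that this is `X` itself. -/
def FiniteEnergy (V : EuclideanSpace ℝ (Fin d) → ℝ) (p : ℝ)
    (φ : EuclideanSpace ℝ (Fin d) → ℂ) : Prop :=
  MemX V φ ∧ MemLp φ (ENNReal.ofReal (p + 1)) volume

/-- The mass `‖φ‖²_{L²}`. -/
def mass (φ : EuclideanSpace ℝ (Fin d) → ℂ) : ℝ := ∫ x, ‖φ x‖ ^ 2

/-- The linear part of the energy, `∫ (½ |∇φ|² + V |φ|²)`. -/
def linearEnergy (V : EuclideanSpace ℝ (Fin d) → ℝ) (φ : EuclideanSpace ℝ (Fin d) → ℂ) : ℝ :=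
  ∫ x, ((1 / 2 : ℝ) * ‖weakGrad φ x‖ ^ 2 + V x * ‖φ x‖ ^ 2)

/-- The energy `E(φ) = ½‖∇φ‖²_{L²} + ∫ V|φ|² + (2/(p+1)) ‖φ‖_{L^{p+1}}^{p+1}`. -/
def energy (V : EuclideanSpace ℝ (Fin d) → ℝ) (p : ℝ)
    (φ : EuclideanSpace ℝ (Fin d) → ℂ) : ℝ :=
  linearEnergy V φ + 2 / (p + 1) * ∫ x, ‖φ x‖ ^ (p + 1)

/-- The action `S_ω(φ) = E(φ) + ω ‖φ‖²_{L²}`. -/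
def action (V : EuclideanSpace ℝ (Fin d) → ℝ) (p ω : ℝ)
    (φ : EuclideanSpace ℝ (Fin d) → ℂ) : ℝ :=
  energy V p φ + ω * mass φ

/-- `φ ≠ 0` is a (weak, finite energy) solution of the stationary equation
`-½ Δφ + Vφ + |φ|^{p-1}φ + ωφ = 0`, i.e. a nonzero critical point of the action: for all `v` of
finite energy, `½∫ ∇φ · conj ∇v + ∫ V φ conj v + ∫ |φ|^{p-1} φ conj v + ω ∫ φ conj v = 0`. -/
def IsStationary (V : EuclideanSpace ℝ (Fin d) → ℝ) (p ω : ℝ)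
    (φ : EuclideanSpace ℝ (Fin d) → ℂ) : Prop :=
  FiniteEnergy V p φ ∧ ¬ (φ =ᵐ[volume] 0) ∧
    ∀ v : EuclideanSpace ℝ (Fin d) → ℂ, FiniteEnergy V p v →
      (1 / 2 : ℂ) * (∫ x, inner ℂ (weakGrad v x) (weakGrad φ x))
        + (∫ x, (V x : ℂ) * (φ x * star (v x)))
        + (∫ x, ((‖φ x‖ ^ (p - 1) : ℝ) : ℂ) * (φ x * star (v x)))
        + (ω : ℂ) * (∫ x, φ x * star (v x)) = 0

/-- `φ` is an action ground state associated with `ω`: it has least action among all the nonzero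
solutions of the stationary equation. -/
def IsActionGroundState (V : EuclideanSpace ℝ (Fin d) → ℝ) (p ω : ℝ)
    (φ : EuclideanSpace ℝ (Fin d) → ℂ) : Prop :=
  IsStationary V p ω φ ∧ ∀ ψ, IsStationary V p ω ψ → action V p ω φ ≤ action V p ω ψ

/-- `φ` is an energy ground state with mass `m > 0`: it has least energy among all the functions
of finite energy and mass `m`. -/
def IsEnergyGroundState (V : EuclideanSpace ℝ (Fin d) → ℝ) (p m : ℝ)
    (φ : EuclideanSpace ℝ (Fin d) → ℂ) : Prop :=
  0 < m ∧ FiniteEnergy V p φ ∧ mass φ = m ∧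
    ∀ ψ, FiniteEnergy V p ψ → mass ψ = m → energy V p φ ≤ energy V p ψ

/-- `ω₀`, the bottom of the spectrum of `-½ Δ + V`, i.e. the infimum over `0 ≠ φ ∈ X` of
`∫ (½ |∇φ|² + V |φ|²) / ‖φ‖²_{L²}`. -/
def omegaZero (V : EuclideanSpace ℝ (Fin d) → ℝ) : ℝ :=
  sInf {r : ℝ | ∃ φ, MemX V φ ∧ ¬ (φ =ᵐ[volume] 0) ∧ r = linearEnergy V φ / mass φ}

end DefocusingNLS

end

/-!
The key point is that an action ground state minimizes the action `S_ω` over *all* functions of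
finite energy, not only over the solutions of the stationary equation
(`IsActionGroundState.action_le`). Granting this, a competitor `ψ` with the same mass as `φ`
satisfies `E(φ) + ω ‖φ‖² ≤ E(ψ) + ω ‖ψ‖²` with equal mass terms, so `E(φ) ≤ E(ψ)`.

To prove the key point, a global minimizer `ψ` of `S_ω` is produced by the direct method
(`exists_isMinOn_action`). It solves the stationary equation
(`FiniteEnergy.firstVariation_eq_zero`), and it is nonzero: testing the equation of the given
ground state `φ` with `φ` itself gives `S_ω(φ) = (2 / (p + 1) - 1) ‖φ‖_{L^{p+1}}^{p+1} < 0`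
(`IsStationary.action_neg`), whence `S_ω(ψ) < 0`, whereas `S_ω(0) = 0`. So `ψ` is among the
competitors of `φ`, and `S_ω(φ) ≤ S_ω(ψ) = min S_ω`.

For the existence of a minimizer, the potential (outside a large ball) and the nonlinearity
(inside it) make the action coercive (`exists_le_action`), and a minimizing sequence has a
subsequence converging in `L²` (`exists_subseq_tendsto_eLpNorm`). For this compactness, the tail is
controlled by the confining potential. On a ball, an `H¹` function is within `ε ‖∇φ‖` of its
average over balls of radius `ε` (`MemH1.lintegral_sub_ballAverage_le`, a consequence of the
translation estimate `MemH1.lintegral_translate_sub_le`), and such averages turn weak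
convergence in `L²` into strong convergence. No weak compactness of the gradients is needed: by the
parallelogram identity the midpoint of two members of the minimizing sequence would have action
below the infimum unless their gradients are close (`FiniteEnergy.action_midpoint_le`,
`cauchySeq_weakGrad_of_minimizing`). Hence the gradients converge strongly as well, and Fatou's
lemma handles the two remaining terms.
-/

noncomputable section

namespace DefocusingNLS

open MeasureTheory Filter Topology

variable {d : ℕ}

/-! ### Linear structure of the space of finite energy functions -/

/-- The Dirichlet integral `‖∇φ‖²_{L²}`. -/
def dirichlet (φ : EuclideanSpace ℝ (Fin d) → ℂ) : ℝ := ∫ x, ‖weakGrad φ x‖ ^ 2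

/-- The potential energy `∫ V |φ|²`. -/
def potentialEnergy (V : EuclideanSpace ℝ (Fin d) → ℝ) (φ : EuclideanSpace ℝ (Fin d) → ℂ) : ℝ :=
  ∫ x, V x * ‖φ x‖ ^ 2

/-- The nonlinear term `‖φ‖_{L^{p+1}}^{p+1}`. -/
def powerIntegral (p : ℝ) (φ : EuclideanSpace ℝ (Fin d) → ℂ) : ℝ := ∫ x, ‖φ x‖ ^ (p + 1)

theorem _root_.MeasureTheory.LocallyIntegrable.coordinate
    {k : EuclideanSpace ℝ (Fin d) → EuclideanSpace ℂ (Fin d)}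
    (hk : LocallyIntegrable k volume) (i : Fin d) :
    LocallyIntegrable (fun x => k x i) volume := by
  intro x
  obtain ⟨s, hs, hks⟩ := hk x
  exact ⟨s, hs, (EuclideanSpace.proj (𝕜 := ℂ) i).integrable_comp hks⟩

theorem IsWeakGrad.add_smul {φ ψ : EuclideanSpace ℝ (Fin d) → ℂ}
    {g h : EuclideanSpace ℝ (Fin d) → EuclideanSpace ℂ (Fin d)}
    (hφ : IsWeakGrad φ g) (hψ : IsWeakGrad ψ h) (c : ℂ) :
    IsWeakGrad (φ + c • ψ) (g + c • h) := by
  refine ⟨hφ.1.add (hψ.1.smul c), hφ.2.1.add (hψ.2.1.smul c), ?_⟩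
  intro η hη hc i
  have hη' : Continuous fun x => fderiv ℝ η x (EuclideanSpace.single i 1) :=
    (hη.continuous_fderiv (by simp)).clm_apply continuous_const
  have hc' : HasCompactSupport fun x => fderiv ℝ η x (EuclideanSpace.single i 1) :=
    hc.fderiv_apply ℝ _
  have i1 := hφ.1.integrable_smul_left_of_hasCompactSupport hη' hc'
  have i2 := hψ.1.integrable_smul_left_of_hasCompactSupport hη' hc'
  have i3 := (hφ.2.1.coordinate i).integrable_smul_left_of_hasCompactSupport hη.continuous hc
  have i4 := (hψ.2.1.coordinate i).integrable_smul_left_of_hasCompactSupport hη.continuous hc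
  simp only [Pi.add_apply, Pi.smul_apply, smul_add, PiLp.add_apply, PiLp.smul_apply]
  simp only [smul_comm _ c]
  have i2' : Integrable (fun x => c • fderiv ℝ η x (EuclideanSpace.single i 1) • ψ x) volume :=
    i2.smul c
  have i4' : Integrable (fun x => c • η x • h x i) volume := i4.smul c
  rw [integral_add i1 i2', integral_add i3 i4', integral_smul, integral_smul,
    hφ.2.2 η hη hc i, hψ.2.2 η hη hc i]
  simp only [smul_neg]
  abel

theorem MemH1.isWeakGrad {φ : EuclideanSpace ℝ (Fin d) → ℂ} (h : MemH1 φ) :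
    IsWeakGrad φ (weakGrad φ) := by
  have hex : ∃ g, IsWeakGrad φ g := h.2.imp fun _ hg => hg.2
  have : weakGrad φ = hex.choose := by simp only [weakGrad, dif_pos hex]
  rw [this]
  exact hex.choose_spec

theorem MemH1.memLp_weakGrad {φ : EuclideanSpace ℝ (Fin d) → ℂ} (h : MemH1 φ) :
    MemLp (weakGrad φ) 2 volume := by
  obtain ⟨g, hg, hφg⟩ := h.2
  exact hg.ae_eq hφg.weakGrad_ae_eq.symm

theorem MemH1.add_smul {φ ψ : EuclideanSpace ℝ (Fin d) → ℂ} (hφ : MemH1 φ) (hψ : MemH1 ψ)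
    (c : ℂ) : MemH1 (φ + c • ψ) :=
  ⟨hφ.1.add (hψ.1.const_smul c), _, hφ.memLp_weakGrad.add (hψ.memLp_weakGrad.const_smul c),
    hφ.isWeakGrad.add_smul hψ.isWeakGrad c⟩

theorem MemH1.weakGrad_add_smul {φ ψ : EuclideanSpace ℝ (Fin d) → ℂ} (hφ : MemH1 φ)
    (hψ : MemH1 ψ) (c : ℂ) :
    weakGrad (φ + c • ψ) =ᵐ[volume] weakGrad φ + c • weakGrad ψ :=
  (hφ.isWeakGrad.add_smul hψ.isWeakGrad c).weakGrad_ae_eq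

/-- The potential energy of `φ` is finite precisely when `√V φ ∈ L²`; this puts the potential
term in the same Hilbert space form as the mass. -/
theorem integrable_potential_iff {V : EuclideanSpace ℝ (Fin d) → ℝ} (hVm : AEMeasurable V volume)
    (hV : ∀ x, 0 ≤ V x) {φ : EuclideanSpace ℝ (Fin d) → ℂ} (hφ : AEStronglyMeasurable φ volume) :
    Integrable (fun x => V x * ‖φ x‖ ^ 2) volume ↔
      MemLp (fun x => ((√(V x) : ℝ) : ℂ) * φ x) 2 volume := by
  have hm : AEStronglyMeasurable (fun x => ((√(V x) : ℝ) : ℂ) * φ x) volume :=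
    (Complex.continuous_ofReal.comp_aestronglyMeasurable
      hVm.sqrt.aestronglyMeasurable).mul hφ
  rw [memLp_two_iff_integrable_sq_norm hm]
  refine integrable_congr (Eventually.of_forall fun x => ?_)
  simp [mul_pow, Real.sq_sqrt (hV x)]

theorem FiniteEnergy.add_smul {V : EuclideanSpace ℝ (Fin d) → ℝ} (hVm : AEMeasurable V volume)
    (hV : ∀ x, 0 ≤ V x) {p : ℝ} {φ ψ : EuclideanSpace ℝ (Fin d) → ℂ}
    (hφ : FiniteEnergy V p φ) (hψ : FiniteEnergy V p ψ) (c : ℂ) :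
    FiniteEnergy V p (φ + c • ψ) := by
  refine ⟨⟨hφ.1.1.add_smul hψ.1.1 c, ?_⟩, hφ.2.add (hψ.2.const_smul c)⟩
  rw [integrable_potential_iff hVm hV (hφ.1.1.add_smul hψ.1.1 c).1.1]
  have h1 := (integrable_potential_iff hVm hV hφ.1.1.1.1).1 hφ.1.2
  have h2 := (integrable_potential_iff hVm hV hψ.1.1.1.1).1 hψ.1.2
  convert h1.add (h2.const_smul c) using 1
  ext x
  simp
  ring

section FiniteEnergy

variable {V : EuclideanSpace ℝ (Fin d) → ℝ} {p : ℝ} {φ : EuclideanSpace ℝ (Fin d) → ℂ}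

theorem FiniteEnergy.integrable_dirichlet (h : FiniteEnergy V p φ) :
    Integrable (fun x => ‖weakGrad φ x‖ ^ 2) volume :=
  (memLp_two_iff_integrable_sq_norm h.1.1.memLp_weakGrad.1).1 h.1.1.memLp_weakGrad

theorem FiniteEnergy.integrable_mass (h : FiniteEnergy V p φ) :
    Integrable (fun x => ‖φ x‖ ^ 2) volume :=
  (memLp_two_iff_integrable_sq_norm h.1.1.1.1).1 h.1.1.1

theorem FiniteEnergy.integrable_power (hp : 1 < p) (h : FiniteEnergy V p φ) :
    Integrable (fun x => ‖φ x‖ ^ (p + 1)) volume := by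
  have := h.2.integrable_norm_rpow (by simp; linarith) (by simp)
  rwa [ENNReal.toReal_ofReal (by linarith)] at this

theorem FiniteEnergy.action_eq (ω : ℝ) (h : FiniteEnergy V p φ) :
    action V p ω φ = 1 / 2 * dirichlet φ + potentialEnergy V φ
      + 2 / (p + 1) * powerIntegral p φ + ω * mass φ := by
  have : linearEnergy V φ = 1 / 2 * dirichlet φ + potentialEnergy V φ := by
    rw [linearEnergy, integral_add (h.integrable_dirichlet.const_mul _) h.1.2, integral_const_mul]
    rfl
  rw [action, energy, this]
  rfl

end FiniteEnergy

theorem dirichlet_nonneg (φ : EuclideanSpace ℝ (Fin d) → ℂ) : 0 ≤ dirichlet φ :=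
  integral_nonneg fun _ => by positivity

theorem potentialEnergy_nonneg {V : EuclideanSpace ℝ (Fin d) → ℝ} (hV : ∀ x, 0 ≤ V x)
    (φ : EuclideanSpace ℝ (Fin d) → ℂ) : 0 ≤ potentialEnergy V φ :=
  integral_nonneg fun x => mul_nonneg (hV x) (by positivity)

theorem powerIntegral_nonneg (p : ℝ) (φ : EuclideanSpace ℝ (Fin d) → ℂ) :
    0 ≤ powerIntegral p φ :=
  integral_nonneg fun _ => by positivity

theorem mass_nonneg (φ : EuclideanSpace ℝ (Fin d) → ℂ) : 0 ≤ mass φ :=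
  integral_nonneg fun _ => by positivity

/-! ### The translation estimate for `H¹` functions -/

theorem integrable_smul_of_memLp_two {α : Type*} [MeasurableSpace α] {μ : Measure α}
    {η : α → ℝ} {f : α → ℂ} (hη : MemLp η 2 μ) (hf : MemLp f 2 μ) :
    Integrable (fun x => η x • f x) μ :=
  memLp_one_iff_integrable.1 (hf.smul hη)

theorem sq_lintegral_le_lintegral_sq {α : Type*} [MeasurableSpace α] {μ : Measure α}
    [IsProbabilityMeasure μ] {f : α → ENNReal} (hf : AEMeasurable f μ) :
    (∫⁻ x, f x ∂μ) ^ 2 ≤ ∫⁻ x, f x ^ 2 ∂μ := by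
  have h := ENNReal.lintegral_mul_le_Lp_mul_Lq μ Real.HolderConjugate.two_two hf
    (aemeasurable_const (b := (1 : ENNReal)))
  simp only [Pi.mul_apply, mul_one, ENNReal.rpow_two, one_pow, lintegral_one, measure_univ,
    ENNReal.one_rpow] at h
  calc (∫⁻ x, f x ∂μ) ^ 2 ≤ ((∫⁻ x, f x ^ 2 ∂μ) ^ (1 / 2 : ℝ)) ^ 2 := by gcongr
    _ = ∫⁻ x, f x ^ 2 ∂μ := by
      rw [← ENNReal.rpow_natCast, ← ENNReal.rpow_mul]
      norm_num

/-- Translating the slice over `t` of a function on a product by `τ t` preserves `Lᵖ`. -/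
theorem memLp_shear {T F : Type*} [MeasurableSpace T] (ν : Measure T) [IsProbabilityMeasure ν]
    {τ : T → EuclideanSpace ℝ (Fin d)} (hτ : Measurable τ) [NormedAddCommGroup F] {q : ENNReal}
    {k : EuclideanSpace ℝ (Fin d) → F} (hk : MemLp k q volume) :
    MemLp (fun z : T × EuclideanSpace ℝ (Fin d) => k (z.2 + τ z.1)) q (ν.prod volume) := by
  have h1 : MeasurePreserving (fun z : T × EuclideanSpace ℝ (Fin d) => (z.1, z.2 + τ z.1))
      (ν.prod volume) (ν.prod volume) := by
    refine (MeasurePreserving.id ν).skew_product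
      (g := fun t x => x + τ t) (measurable_snd.add (hτ.comp measurable_fst)) ?_
    exact Eventually.of_forall fun t => (measurePreserving_add_right volume (τ t)).map_eq
  exact (hk.comp_measurePreserving measurePreserving_snd).comp_measurePreserving h1

/-- If `k` is the weak derivative of `φ` in the direction `h`, then
`φ (x + h) - φ x = ∫₀¹ k (x + t h) dt` for almost every `x`: the two sides have the same integral
against every test function, by Fubini's theorem and the fundamental theorem of calculus for the
test function. -/
theorem sub_eq_integral_of_directional {φ k : EuclideanSpace ℝ (Fin d) → ℂ}
    (h : EuclideanSpace ℝ (Fin d)) (hφ : MemLp φ 2 volume) (hk : MemLp k 2 volume)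
    (hd : ∀ η : EuclideanSpace ℝ (Fin d) → ℝ, ContDiff ℝ ((⊤ : ℕ∞) : WithTop ℕ∞) η →
      HasCompactSupport η → ∫ x, (fderiv ℝ η x h) • φ x = -∫ x, η x • k x) :
    ∀ᵐ x, φ (x + h) - φ x = ∫ t in Set.Ioc (0 : ℝ) 1, k (x + t • h) := by
  have : IsProbabilityMeasure (volume.restrict (Set.Ioc (0 : ℝ) 1)) := ⟨by simp⟩
  have hφh : MemLp (fun x => φ (x + h)) 2 volume :=
    hφ.comp_measurePreserving (measurePreserving_add_right volume h)
  have hK := memLp_shear (volume.restrict (Set.Ioc (0 : ℝ) 1)) (measurable_id.smul_const h) hk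
  have hsnd : MeasurePreserving (Prod.snd : ℝ × EuclideanSpace ℝ (Fin d) → _)
      ((volume.restrict (Set.Ioc (0 : ℝ) 1)).prod volume) volume := measurePreserving_snd
  refine ae_eq_of_integral_contDiff_smul_eq
    ((hφh.sub hφ).locallyIntegrable (by norm_num)) ?_ ?_
  · rw [locallyIntegrable_iff]
    intro S hS
    have : IsFiniteMeasure (volume.restrict S) := ⟨by simpa using hS.measure_lt_top⟩
    have h1 : MemLp (fun z : ℝ × EuclideanSpace ℝ (Fin d) => k (z.2 + z.1 • h)) 2
        ((volume.restrict (Set.Ioc (0 : ℝ) 1)).prod (volume.restrict S)) :=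
      hK.mono_measure (Measure.prod_mono le_rfl Measure.restrict_le_self)
    exact (h1.integrable (by norm_num)).integral_prod_right
  · intro η hη hc
    have hηc := hη.continuous
    have hη2 : MemLp η 2 volume := hηc.memLp_of_hasCompactSupport hc
    have hη' : Continuous fun x => fderiv ℝ η x h :=
      (hη.continuous_fderiv (by simp)).clm_apply continuous_const
    have hη'2 : MemLp (fun x => fderiv ℝ η x h) 2 volume :=
      hη'.memLp_of_hasCompactSupport (hc.fderiv_apply ℝ h)
    -- integrability on the product, for the two applications of Fubini's theorem
    have j1 : Integrable (fun z : ℝ × EuclideanSpace ℝ (Fin d) => η z.2 • k (z.2 + z.1 • h))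
        ((volume.restrict (Set.Ioc (0 : ℝ) 1)).prod volume) :=
      integrable_smul_of_memLp_two (hη2.comp_measurePreserving hsnd) hK
    have j2 : Integrable (fun z : ℝ × EuclideanSpace ℝ (Fin d) =>
        fderiv ℝ η (z.2 + z.1 • (-h)) h • φ z.2)
        ((volume.restrict (Set.Ioc (0 : ℝ) 1)).prod volume) :=
      integrable_smul_of_memLp_two
        (memLp_shear (volume.restrict (Set.Ioc (0 : ℝ) 1)) (measurable_id.smul_const (-h)) hη'2)
        (hφ.comp_measurePreserving hsnd)
    -- the hypothesis for the translate of `η` by `-t h`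
    have slice : ∀ t : ℝ, ∫ x, η x • k (x + t • h) =
        -∫ x, fderiv ℝ η (x + t • (-h)) h • φ x := by
      intro t
      have hs := hd (fun x => η (x + t • (-h))) (hη.comp (contDiff_id.add contDiff_const))
        (hc.comp_homeomorph (Homeomorph.addRight (t • (-h))))
      simp only [fderiv_comp_add_right] at hs
      rw [hs, neg_neg, ← integral_add_right_eq_self (fun x => η (x + t • (-h)) • k x) (t • h)]
      simp
    have ftc : ∀ x, ∫ t in Set.Ioc (0 : ℝ) 1, fderiv ℝ η (x + t • (-h)) h = η x - η (x - h) := by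
      intro x
      have hder : ∀ t ∈ Set.uIcc (0 : ℝ) 1, HasDerivAt (fun t : ℝ => -η (x + t • (-h)))
          (fderiv ℝ η (x + t • (-h)) h) t := by
        intro t _
        have e1 : HasDerivAt (fun t : ℝ => x + t • (-h)) (-h) t := by
          simpa using ((hasDerivAt_id t).smul_const (-h)).const_add x
        have e2 := ((hη.differentiable (by simp)) (x + t • (-h))).hasFDerivAt.comp_hasDerivAt t e1
        simpa using! e2.neg
      rw [← intervalIntegral.integral_of_le zero_le_one,
        intervalIntegral.integral_eq_sub_of_hasDerivAt hder
          ((hη'.comp (by fun_prop : Continuous fun t : ℝ => x + t • (-h))).intervalIntegrable _ _)]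
      simp [sub_eq_add_neg, add_comm]
    have i1 : Integrable (fun x => η x • φ (x + h)) volume := integrable_smul_of_memLp_two hη2 hφh
    have i2 : Integrable (fun x => η x • φ x) volume := integrable_smul_of_memLp_two hη2 hφ
    have hηh : MemLp (fun x => η (x - h)) 2 volume := by
      simpa [sub_eq_add_neg] using!
        hη2.comp_measurePreserving (measurePreserving_add_right volume (-h))
    have i3 : Integrable (fun x => η (x - h) • φ x) volume := integrable_smul_of_memLp_two hηh hφ
    calc ∫ x, η x • (φ (x + h) - φ x)
        = (∫ x, η x • φ (x + h)) - ∫ x, η x • φ x := by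
          simp only [smul_sub]; exact integral_sub i1 i2
      _ = (∫ x, η (x - h) • φ x) - ∫ x, η x • φ x := by
          congr 1
          rw [← integral_add_right_eq_self (fun x => η (x - h) • φ x) h]
          simp
      _ = -∫ x, (η x - η (x - h)) • φ x := by
          simp only [sub_smul]; rw [integral_sub i2 i3]; ring
      _ = -∫ x, ∫ t in Set.Ioc (0 : ℝ) 1, fderiv ℝ η (x + t • (-h)) h • φ x := by
          simp only [← ftc, integral_smul_const]
      _ = -∫ t in Set.Ioc (0 : ℝ) 1, ∫ x, fderiv ℝ η (x + t • (-h)) h • φ x := by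
          rw [integral_integral_swap]; exact j2.swap
      _ = ∫ t in Set.Ioc (0 : ℝ) 1, ∫ x, η x • k (x + t • h) := by
          simp only [slice, integral_neg]
      _ = ∫ x, ∫ t in Set.Ioc (0 : ℝ) 1, η x • k (x + t • h) := by
          rw [integral_integral_swap]; exact j1
      _ = ∫ x, η x • ∫ t in Set.Ioc (0 : ℝ) 1, k (x + t • h) := by
          simp only [integral_smul]

/-- The directional component `∑ᵢ hᵢ wᵢ` of a gradient vector `w`. -/
def directional (h : EuclideanSpace ℝ (Fin d)) : EuclideanSpace ℂ (Fin d) →L[ℂ] ℂ :=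
  ∑ i, (h i : ℂ) • EuclideanSpace.proj i

theorem norm_directional_le (h : EuclideanSpace ℝ (Fin d)) (w : EuclideanSpace ℂ (Fin d)) :
    ‖directional h w‖ ≤ ‖h‖ * ‖w‖ := by
  have h1 : directional h w = ∑ i, (h i : ℂ) * w i := by simp [directional]
  rw [h1, EuclideanSpace.norm_eq, EuclideanSpace.norm_eq]
  refine (norm_sum_le _ _).trans ?_
  simp only [norm_mul, Complex.norm_real]
  exact Real.sum_mul_le_sqrt_mul_sqrt _ _ _

theorem IsWeakGrad.integral_fderiv_smul {φ : EuclideanSpace ℝ (Fin d) → ℂ}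
    {g : EuclideanSpace ℝ (Fin d) → EuclideanSpace ℂ (Fin d)} (hg : IsWeakGrad φ g)
    (h : EuclideanSpace ℝ (Fin d)) {η : EuclideanSpace ℝ (Fin d) → ℝ}
    (hη : ContDiff ℝ ((⊤ : ℕ∞) : WithTop ℕ∞) η) (hc : HasCompactSupport η) :
    ∫ x, (fderiv ℝ η x h) • φ x = -∫ x, η x • directional h (g x) := by
  have hη' : ∀ i : Fin d, Integrable
      (fun x => (fderiv ℝ η x (EuclideanSpace.single i 1)) • φ x) volume := fun i =>
    hg.1.integrable_smul_left_of_hasCompactSupport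
      ((hη.continuous_fderiv (by simp)).clm_apply continuous_const) (hc.fderiv_apply ℝ _)
  have hηg : ∀ i : Fin d, Integrable (fun x => η x • g x i) volume := fun i =>
    (hg.2.1.coordinate i).integrable_smul_left_of_hasCompactSupport hη.continuous hc
  have e1 : ∀ x, (fderiv ℝ η x h) • φ x =
      ∑ i, (h i) • ((fderiv ℝ η x (EuclideanSpace.single i 1)) • φ x) := by
    intro x
    have : h = ∑ i, h i • EuclideanSpace.single i (1 : ℝ) := by
      simpa using ((EuclideanSpace.basisFun (Fin d) ℝ).sum_repr h).symm
    conv_lhs => rw [this]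
    rw [map_sum, Finset.sum_smul]
    simp [mul_assoc]
  have e2 : ∀ x, η x • directional h (g x) = ∑ i, (h i) • (η x • g x i) := by
    intro x
    simp only [directional, _root_.sum_apply, Finset.smul_sum]
    refine Finset.sum_congr rfl fun i _ => ?_
    simp
    ring
  simp only [e1, e2]
  rw [integral_finsetSum _ fun i _ => (hη' i).fun_smul (h i),
    integral_finsetSum _ fun i _ => (hηg i).fun_smul (h i), ← Finset.sum_neg_distrib]
  refine Finset.sum_congr rfl fun i _ => ?_
  rw [integral_smul, integral_smul, hg.2.2 η hη hc i, smul_neg]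

/-- A translation by `h` moves an `H¹` function by at most `‖h‖ ‖∇φ‖` in `L²`. -/
theorem MemH1.lintegral_translate_sub_le {φ : EuclideanSpace ℝ (Fin d) → ℂ} (hφ : MemH1 φ)
    (h : EuclideanSpace ℝ (Fin d)) :
    ∫⁻ x, ‖φ (x + h) - φ x‖ₑ ^ 2 ≤ ‖h‖ₑ ^ 2 * ∫⁻ x, ‖weakGrad φ x‖ₑ ^ 2 := by
  have : IsProbabilityMeasure (volume.restrict (Set.Ioc (0 : ℝ) 1)) := ⟨by simp⟩
  have hg := hφ.memLp_weakGrad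
  have hk : MemLp (fun x => directional h (weakGrad φ x)) 2 volume :=
    (directional h).comp_memLp' hg
  have hae := sub_eq_integral_of_directional h hφ.1 hk
    fun η hη hc => hφ.isWeakGrad.integral_fderiv_smul h hη hc
  have hsh := (memLp_shear (volume.restrict (Set.Ioc (0 : ℝ) 1)) (measurable_id.smul_const h) hg).1
  have hm := hsh.enorm.pow_const 2
  have hmt : ∀ᵐ x : EuclideanSpace ℝ (Fin d), AEMeasurable
      (fun t : ℝ => ‖weakGrad φ (x + t • h)‖ₑ) (volume.restrict (Set.Ioc (0 : ℝ) 1)) := by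
    filter_upwards [hsh.prodMk_right] with x hx using hx.enorm
  calc ∫⁻ x, ‖φ (x + h) - φ x‖ₑ ^ 2
      ≤ ∫⁻ x, ∫⁻ t in Set.Ioc (0 : ℝ) 1, ‖h‖ₑ ^ 2 * ‖weakGrad φ (x + t • h)‖ₑ ^ 2 := by
        refine lintegral_mono_ae ?_
        filter_upwards [hae, hmt] with x hx hxm
        rw [hx]
        calc ‖∫ t in Set.Ioc (0 : ℝ) 1, directional h (weakGrad φ (x + t • h))‖ₑ ^ 2
            ≤ (∫⁻ t in Set.Ioc (0 : ℝ) 1, ‖h‖ₑ * ‖weakGrad φ (x + t • h)‖ₑ) ^ 2 := by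
              gcongr
              refine (enorm_integral_le_lintegral_enorm _).trans (lintegral_mono fun t => ?_)
              have := norm_directional_le h (weakGrad φ (x + t • h))
              rw [← ofReal_norm, ← ofReal_norm, ← ofReal_norm, ← ENNReal.ofReal_mul (norm_nonneg _)]
              exact ENNReal.ofReal_le_ofReal this
          _ ≤ ∫⁻ t in Set.Ioc (0 : ℝ) 1, (‖h‖ₑ * ‖weakGrad φ (x + t • h)‖ₑ) ^ 2 :=
              sq_lintegral_le_lintegral_sq (hxm.const_mul _)
          _ = _ := by simp only [mul_pow]
    _ = ∫⁻ t in Set.Ioc (0 : ℝ) 1, ∫⁻ x, ‖h‖ₑ ^ 2 * ‖weakGrad φ (x + t • h)‖ₑ ^ 2 := by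
        rw [lintegral_lintegral_swap]
        exact (hm.const_mul (‖h‖ₑ ^ 2)).prod_swap
    _ = ∫⁻ t in Set.Ioc (0 : ℝ) 1, ‖h‖ₑ ^ 2 * ∫⁻ x, ‖weakGrad φ x‖ₑ ^ 2 := by
        refine lintegral_congr fun t => ?_
        rw [lintegral_const_mul' _ _ (by finiteness)]
        congr 1
        exact lintegral_add_right_eq_self (fun x => ‖weakGrad φ x‖ₑ ^ 2) (t • h)
    _ = ‖h‖ₑ ^ 2 * ∫⁻ x, ‖weakGrad φ x‖ₑ ^ 2 := by simp

/-! ### Averages over balls -/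

theorem lintegral_enorm_sq_eq {α F : Type*} [MeasurableSpace α] {μ : Measure α}
    [NormedAddCommGroup F] {f : α → F} (hf : MemLp f 2 μ) :
    ∫⁻ x, ‖f x‖ₑ ^ 2 ∂μ = ENNReal.ofReal (∫ x, ‖f x‖ ^ 2 ∂μ) := by
  rw [ofReal_integral_eq_lintegral_ofReal ((memLp_two_iff_integrable_sq_norm hf.1).1 hf)
    (Eventually.of_forall fun x => by positivity)]
  refine lintegral_congr fun x => ?_
  rw [ENNReal.ofReal_pow (norm_nonneg _), ofReal_norm]

theorem eLpNorm_two_le_of_lintegral_le {α F : Type*} [MeasurableSpace α] {μ : Measure α}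
    [NormedAddCommGroup F] {f : α → F} {δ : ENNReal} (h : ∫⁻ x, ‖f x‖ₑ ^ 2 ∂μ ≤ δ ^ 2) :
    eLpNorm f 2 μ ≤ δ := by
  have h2 : eLpNorm f 2 μ = (∫⁻ x, ‖f x‖ₑ ^ 2 ∂μ) ^ (1 / 2 : ℝ) := by
    rw [eLpNorm_eq_lintegral_rpow_enorm_toReal (by norm_num) (by norm_num)]
    simp
  rw [h2]
  calc (∫⁻ x, ‖f x‖ₑ ^ 2 ∂μ) ^ (1 / 2 : ℝ) ≤ (δ ^ 2) ^ (1 / 2 : ℝ) := by gcongr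
    _ = δ := by rw [← ENNReal.rpow_natCast, ← ENNReal.rpow_mul]; norm_num

/-- The uniform probability measure on the ball of radius `ε` about the origin. -/
def unifBall (d : ℕ) (ε : ℝ) : Measure (EuclideanSpace ℝ (Fin d)) :=
  (volume (Metric.ball (0 : EuclideanSpace ℝ (Fin d)) ε))⁻¹ •
    volume.restrict (Metric.ball (0 : EuclideanSpace ℝ (Fin d)) ε)

theorem isProbabilityMeasure_unifBall {ε : ℝ} (hε : 0 < ε) :
    IsProbabilityMeasure (unifBall d ε) := by
  refine ⟨?_⟩
  simp only [unifBall, Measure.smul_apply, Measure.restrict_apply_univ, smul_eq_mul]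
  exact ENNReal.inv_mul_cancel (Metric.measure_ball_pos _ _ hε).ne' measure_ball_lt_top.ne

/-- The average of `f` over the ball of radius `ε` about `x`. -/
def ballAverage (ε : ℝ) (f : EuclideanSpace ℝ (Fin d) → ℂ) (x : EuclideanSpace ℝ (Fin d)) : ℂ :=
  ∫ z, f (x + z) ∂unifBall d ε

theorem ballAverage_eq (ε : ℝ) (f : EuclideanSpace ℝ (Fin d) → ℂ)
    (x : EuclideanSpace ℝ (Fin d)) :
    ballAverage ε f x = (volume (Metric.ball (0 : EuclideanSpace ℝ (Fin d)) ε))⁻¹.toReal •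
      ∫ y in Metric.ball x ε, f y := by
  rw [ballAverage, unifBall, integral_smul_measure]
  congr 1
  have := (measurePreserving_add_left (volume : Measure (EuclideanSpace ℝ (Fin d))) x)
    |>.setIntegral_preimage_emb (measurableEmbedding_addLeft x) f (Metric.ball x ε)
  rw [← this]
  simp

theorem memLp_translate_unifBall {ε : ℝ} (hε : 0 < ε) {f : EuclideanSpace ℝ (Fin d) → ℂ}
    (hf : MemLp f 2 volume) (x : EuclideanSpace ℝ (Fin d)) :
    MemLp (fun z => f (x + z)) 2 (unifBall d ε) := by
  have h := hf.comp_measurePreserving (measurePreserving_add_left volume x)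
  exact (h.mono_measure Measure.restrict_le_self).smul_measure
    (ENNReal.inv_ne_top.2 (Metric.measure_ball_pos _ _ hε).ne')

theorem aestronglyMeasurable_ballAverage {ε : ℝ} (hε : 0 < ε)
    {f : EuclideanSpace ℝ (Fin d) → ℂ} (hf : MemLp f 2 volume) :
    AEStronglyMeasurable (ballAverage ε f) volume := by
  have := isProbabilityMeasure_unifBall (d := d) hε
  exact (memLp_shear (unifBall d ε) measurable_id hf).1.prod_swap.integral_prod_right'

theorem enorm_ballAverage_sq_le {ε : ℝ} (hε : 0 < ε)
    {f : EuclideanSpace ℝ (Fin d) → ℂ} (hf : MemLp f 2 volume) (x : EuclideanSpace ℝ (Fin d)) :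
    ‖ballAverage ε f x‖ₑ ^ 2 ≤
      (volume (Metric.ball (0 : EuclideanSpace ℝ (Fin d)) ε))⁻¹ * ∫⁻ y, ‖f y‖ₑ ^ 2 := by
  have := isProbabilityMeasure_unifBall (d := d) hε
  calc ‖ballAverage ε f x‖ₑ ^ 2 ≤ (∫⁻ z, ‖f (x + z)‖ₑ ∂unifBall d ε) ^ 2 := by
        gcongr; exact enorm_integral_le_lintegral_enorm _
    _ ≤ ∫⁻ z, ‖f (x + z)‖ₑ ^ 2 ∂unifBall d ε :=
        sq_lintegral_le_lintegral_sq (memLp_translate_unifBall hε hf x).1.enorm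
    _ ≤ (volume (Metric.ball (0 : EuclideanSpace ℝ (Fin d)) ε))⁻¹ * ∫⁻ z, ‖f (x + z)‖ₑ ^ 2 := by
        rw [unifBall, lintegral_smul_measure, smul_eq_mul]
        gcongr
        exact Measure.restrict_le_self
    _ = _ := by rw [lintegral_add_left_eq_self (fun y => ‖f y‖ₑ ^ 2) x]

/-- Averaging over balls of radius `ε` moves an `H¹` function by at most `ε ‖∇φ‖` in `L²`. -/
theorem MemH1.lintegral_sub_ballAverage_le {φ : EuclideanSpace ℝ (Fin d) → ℂ} (hφ : MemH1 φ)
    {ε : ℝ} (hε : 0 < ε) :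
    ∫⁻ x, ‖φ x - ballAverage ε φ x‖ₑ ^ 2 ≤
      ENNReal.ofReal ε ^ 2 * ∫⁻ x, ‖weakGrad φ x‖ₑ ^ 2 := by
  have := isProbabilityMeasure_unifBall (d := d) hε
  have hae : ∀ᵐ z ∂unifBall d ε, ‖z‖ₑ ≤ ENNReal.ofReal ε := by
    refine Measure.ae_smul_measure ?_ _
    filter_upwards [ae_restrict_mem Metric.isOpen_ball.measurableSet] with z hz
    rw [← ofReal_norm]
    exact ENNReal.ofReal_le_ofReal (mem_ball_zero_iff.1 hz).le
  have hm : AEMeasurable (fun w : EuclideanSpace ℝ (Fin d) × EuclideanSpace ℝ (Fin d) =>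
      ‖φ (w.1 + w.2) - φ w.1‖ₑ ^ 2) (volume.prod (unifBall d ε)) := by
    have h1 := (memLp_shear (unifBall d ε) measurable_id hφ.1).1.prod_swap
    have h2 := hφ.1.1.comp_fst (ν := unifBall d ε)
    exact (h1.sub h2).enorm.pow_const 2
  calc ∫⁻ x, ‖φ x - ballAverage ε φ x‖ₑ ^ 2
      ≤ ∫⁻ x, ∫⁻ z, ‖φ (x + z) - φ x‖ₑ ^ 2 ∂unifBall d ε := by
        refine lintegral_mono fun x => ?_
        have hx := memLp_translate_unifBall hε hφ.1 x
        have e : ballAverage ε φ x - φ x = ∫ z, (φ (x + z) - φ x) ∂unifBall d ε := by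
          rw [integral_sub (hx.integrable (by norm_num)) (integrable_const _)]
          simp [ballAverage]
        rw [enorm_sub_rev, e]
        calc _ ≤ (∫⁻ z, ‖φ (x + z) - φ x‖ₑ ∂unifBall d ε) ^ 2 := by
              gcongr; exact enorm_integral_le_lintegral_enorm _
          _ ≤ _ := sq_lintegral_le_lintegral_sq (hx.1.sub aestronglyMeasurable_const).enorm
    _ = ∫⁻ z, (∫⁻ x, ‖φ (x + z) - φ x‖ₑ ^ 2) ∂unifBall d ε := lintegral_lintegral_swap hm
    _ ≤ ∫⁻ _, (ENNReal.ofReal ε ^ 2 * ∫⁻ x, ‖weakGrad φ x‖ₑ ^ 2) ∂unifBall d ε := by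
        refine lintegral_mono_ae ?_
        filter_upwards [hae] with z hz
        refine (hφ.lintegral_translate_sub_le z).trans ?_
        gcongr
    _ = _ := by simp

/-- From an `L²`-bounded sequence one can extract a subsequence whose averages over balls converge
pointwise, simultaneously for all radii. -/
theorem exists_subseq_tendsto_ballAverage {u : ℕ → EuclideanSpace ℝ (Fin d) → ℂ}
    (hu : ∀ n, MemLp (u n) 2 volume) {C : ENNReal} (hC : C ≠ ⊤)
    (hb : ∀ n, eLpNorm (u n) 2 volume ≤ C) :
    ∃ σ : ℕ → ℕ, StrictMono σ ∧ ∀ ε x, ∃ a, Tendsto (fun n => ballAverage ε (u (σ n)) x)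
      atTop (𝓝 a) := by
  have : Fact ((2 : ENNReal) ≠ ⊤) := ⟨by norm_num⟩
  have hmem : ∀ n, StrongDual.toWeakDual (InnerProductSpace.toDual ℂ _ ((hu n).toLp (u n))) ∈
      WeakDual.toStrongDual ⁻¹' Metric.closedBall
        (0 : StrongDual ℂ (Lp ℂ 2 (volume : Measure (EuclideanSpace ℝ (Fin d))))) C.toReal := by
    intro n
    simp only [Set.mem_preimage, mem_closedBall_zero_iff]
    change ‖InnerProductSpace.toDual ℂ _ ((hu n).toLp (u n))‖ ≤ _
    rw [LinearIsometryEquiv.norm_map, Lp.norm_toLp]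
    exact ENNReal.toReal_mono hC (hb n)
  obtain ⟨Λ, -, σ, hσ, hlim⟩ := WeakDual.isSeqCompact_closedBall ℂ
    (Lp ℂ 2 (volume : Measure (EuclideanSpace ℝ (Fin d)))) 0 C.toReal hmem
  refine ⟨σ, hσ, fun ε x => ?_⟩
  -- the average over a ball is a multiple of the pairing with its indicator function
  have key : ∀ n, (starRingEnd ℂ) (InnerProductSpace.toDual ℂ _ ((hu n).toLp (u n))
      (indicatorConstLp 2 (Metric.isOpen_ball (x := x) (ε := ε)).measurableSet
        measure_ball_lt_top.ne (1 : ℂ))) = ∫ y in Metric.ball x ε, u n y := by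
    intro n
    rw [InnerProductSpace.toDual_apply_apply, inner_conj_symm, L2.inner_indicatorConstLp_one]
    exact setIntegral_congr_ae Metric.isOpen_ball.measurableSet
      ((hu n).coeFn_toLp.mono fun y hy _ => hy)
  simp only [ballAverage_eq, ← key]
  refine ⟨_, Tendsto.const_smul (Tendsto.comp (Complex.continuous_conj.tendsto _)
    (((WeakDual.eval_continuous _).tendsto Λ).comp hlim)) _⟩

/-! ### Compactness in `L²` -/

theorem exists_closedBall_le {V : EuclideanSpace ℝ (Fin d) → ℝ}
    (hVc : Tendsto V (cocompact (EuclideanSpace ℝ (Fin d))) atTop) (L : ℝ) :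
    ∃ R : ℝ, ∀ x ∉ Metric.closedBall (0 : EuclideanSpace ℝ (Fin d)) R, L ≤ V x := by
  have h := hVc.eventually_ge_atTop L
  rw [← Metric.cobounded_eq_cocompact] at h
  obtain ⟨R, -, hR⟩ := (Metric.hasBasis_cobounded_compl_closedBall
    (0 : EuclideanSpace ℝ (Fin d))).eventually_iff.1 h
  exact ⟨R, fun x hx => hR hx⟩

/-- A bound on the potential energy controls the mass outside a large ball. -/
theorem ofReal_mul_lintegral_le_potentialEnergy {V : EuclideanSpace ℝ (Fin d) → ℝ}
    (hV : ∀ x, 0 ≤ V x) {φ : EuclideanSpace ℝ (Fin d) → ℂ} (hφ : MemX V φ) {L : ℝ}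
    {s : Set (EuclideanSpace ℝ (Fin d))} (hs : MeasurableSet s) (hL : ∀ x ∈ s, L ≤ V x) :
    ENNReal.ofReal L * ∫⁻ x in s, ‖φ x‖ₑ ^ 2 ≤ ENNReal.ofReal (potentialEnergy V φ) := by
  rw [potentialEnergy, ofReal_integral_eq_lintegral_ofReal hφ.2
    (Eventually.of_forall fun x => mul_nonneg (hV x) (by positivity)),
    ← lintegral_const_mul' _ _ ENNReal.ofReal_ne_top]
  refine (lintegral_mono_ae ?_).trans (lintegral_mono' Measure.restrict_le_self le_rfl)
  filter_upwards [ae_restrict_mem hs] with x hx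
  rw [ENNReal.ofReal_mul (hV x), ENNReal.ofReal_pow (norm_nonneg _), ofReal_norm]
  gcongr
  exact hL x hx

/-- Functions with bounded Dirichlet integral and potential energy are uniformly approximated in
`L²` by their ball averages, cut off outside a large ball. -/
theorem exists_eLpNorm_sub_indicator_ballAverage_le {V : EuclideanSpace ℝ (Fin d) → ℝ}
    (hV : ∀ x, 0 ≤ V x) (hVc : Tendsto V (cocompact (EuclideanSpace ℝ (Fin d))) atTop)
    (C : ℝ) {δ : ℝ} (hδ : 0 < δ) :
    ∃ ε > 0, ∃ R : ℝ, ∀ φ : EuclideanSpace ℝ (Fin d) → ℂ, MemX V φ → dirichlet φ ≤ C →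
      potentialEnergy V φ ≤ C →
      eLpNorm (φ - (Metric.closedBall 0 R).indicator (ballAverage ε φ)) 2 volume ≤
        ENNReal.ofReal δ := by
  set K : ℝ := 2 * (|C| + 1) with hK
  have hK0 : 0 < K := by positivity
  have hCK : C ≤ K / 2 := by rw [hK]; linarith [le_abs_self C]
  -- `V ≥ K / δ²` off the ball and averaging at radius `δ / √K` each cost at most `δ² / 2`
  obtain ⟨R, hR⟩ := exists_closedBall_le hVc (K / δ ^ 2)
  refine ⟨√(δ ^ 2 / K), by positivity, R, fun φ hφ hD hP => ?_⟩
  have hB : MeasurableSet (Metric.closedBall (0 : EuclideanSpace ℝ (Fin d)) R) :=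
    Metric.isClosed_closedBall.measurableSet
  refine eLpNorm_two_le_of_lintegral_le ?_
  rw [← lintegral_add_compl _ hB]
  have h1 : ∫⁻ x in Metric.closedBall 0 R,
      ‖(φ - (Metric.closedBall 0 R).indicator (ballAverage √(δ ^ 2 / K) φ)) x‖ₑ ^ 2 ≤
      ENNReal.ofReal (δ ^ 2 / 2) := by
    calc _ = ∫⁻ x in Metric.closedBall 0 R, ‖φ x - ballAverage √(δ ^ 2 / K) φ x‖ₑ ^ 2 := by
          refine setLIntegral_congr_fun hB fun x hx => ?_
          simp [Set.indicator_of_mem hx]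
      _ ≤ ∫⁻ x, ‖φ x - ballAverage √(δ ^ 2 / K) φ x‖ₑ ^ 2 := setLIntegral_le_lintegral _ _
      _ ≤ _ := hφ.1.lintegral_sub_ballAverage_le (by positivity)
      _ ≤ ENNReal.ofReal (δ ^ 2 / 2) := by
          rw [lintegral_enorm_sq_eq hφ.1.memLp_weakGrad, ← ENNReal.ofReal_pow (by positivity),
            Real.sq_sqrt (by positivity), ← ENNReal.ofReal_mul (by positivity)]
          refine ENNReal.ofReal_le_ofReal ?_
          calc δ ^ 2 / K * dirichlet φ ≤ δ ^ 2 / K * (K / 2) := by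
                gcongr; exact hD.trans hCK
            _ = δ ^ 2 / 2 := by field_simp
  have h2 : ∫⁻ x in (Metric.closedBall 0 R)ᶜ,
      ‖(φ - (Metric.closedBall 0 R).indicator (ballAverage √(δ ^ 2 / K) φ)) x‖ₑ ^ 2 ≤
      ENNReal.ofReal (δ ^ 2 / 2) := by
    calc _ = ∫⁻ x in (Metric.closedBall 0 R)ᶜ, ‖φ x‖ₑ ^ 2 := by
          refine setLIntegral_congr_fun hB.compl fun x hx => ?_
          have hx' : x ∉ Metric.closedBall 0 R := hx
          simp only [Pi.sub_apply, Set.indicator_of_notMem hx', sub_zero]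
      _ ≤ ENNReal.ofReal (δ ^ 2 / 2) := by
          have h := ofReal_mul_lintegral_le_potentialEnergy hV hφ hB.compl hR
          have h3 : ENNReal.ofReal (K / δ ^ 2) ≠ 0 := by
            simpa using div_pos hK0 (by positivity)
          rw [← ENNReal.mul_le_mul_iff_right h3 ENNReal.ofReal_ne_top]
          refine h.trans ?_
          rw [← ENNReal.ofReal_mul (by positivity)]
          refine ENNReal.ofReal_le_ofReal ((hP.trans hCK).trans_eq ?_)
          field_simp
  calc _ ≤ ENNReal.ofReal (δ ^ 2 / 2) + ENNReal.ofReal (δ ^ 2 / 2) := add_le_add h1 h2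
    _ = ENNReal.ofReal δ ^ 2 := by
      rw [← ENNReal.ofReal_add (by positivity) (by positivity), add_halves,
        ENNReal.ofReal_pow hδ.le]

/-- Pointwise convergence of ball averages of an `L²`-bounded sequence upgrades to `L²` convergence
on balls, by dominated convergence. -/
theorem exists_tendsto_indicator_ballAverage {u : ℕ → EuclideanSpace ℝ (Fin d) → ℂ}
    (hu : ∀ n, MemLp (u n) 2 volume) {C : ENNReal} (hC : C ≠ ⊤)
    (hb : ∀ n, ∫⁻ x, ‖u n x‖ₑ ^ 2 ≤ C) {ε : ℝ} (hε : 0 < ε) (R : ℝ)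
    (hlim : ∀ x, ∃ a, Tendsto (fun n => ballAverage ε (u n) x) atTop (𝓝 a)) :
    ∃ w : EuclideanSpace ℝ (Fin d) → ℂ, AEStronglyMeasurable w volume ∧
      Tendsto (fun n => eLpNorm ((Metric.closedBall 0 R).indicator (ballAverage ε (u n)) - w) 2
        volume) atTop (𝓝 0) := by
  choose a ha using hlim
  have hB : MeasurableSet (Metric.closedBall (0 : EuclideanSpace ℝ (Fin d)) R) :=
    Metric.isClosed_closedBall.measurableSet
  have hAm := fun n => aestronglyMeasurable_ballAverage hε (hu n)
  have ham : AEStronglyMeasurable a volume :=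
    aestronglyMeasurable_of_tendsto_ae atTop hAm (Eventually.of_forall ha)
  set K : ENNReal := (volume (Metric.ball (0 : EuclideanSpace ℝ (Fin d)) ε))⁻¹ * C with hK
  have hKt : K ≠ ⊤ := ENNReal.mul_ne_top
    (ENNReal.inv_ne_top.2 (Metric.measure_ball_pos _ _ hε).ne') hC
  have hAK : ∀ n x, ‖ballAverage ε (u n) x‖ₑ ^ 2 ≤ K := fun n x =>
    (enorm_ballAverage_sq_le hε (hu n) x).trans (by rw [hK]; gcongr; exact hb n)
  have haK : ∀ x, ‖a x‖ₑ ^ 2 ≤ K := fun x =>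
    le_of_tendsto' ((ENNReal.continuous_pow 2).tendsto _ |>.comp (ha x).enorm) fun n => hAK n x
  have e1 : ∀ x y : ℂ, ‖x‖ₑ ^ 2 ≤ K → ‖y‖ₑ ^ 2 ≤ K → ‖x - y‖ₑ ^ 2 ≤ 4 * K := by
    intro x y hx hy
    have hle : ∀ s t : ENNReal, s ≤ t → t ^ 2 ≤ K → (s + t) ^ 2 ≤ 4 * K := fun s t hst ht =>
      calc (s + t) ^ 2 ≤ (t + t) ^ 2 := by gcongr
        _ = 4 * t ^ 2 := by ring
        _ ≤ 4 * K := by gcongr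
    calc ‖x - y‖ₑ ^ 2 ≤ (‖x‖ₑ + ‖y‖ₑ) ^ 2 := by gcongr; exact enorm_sub_le
      _ ≤ 4 * K := (le_total ‖x‖ₑ ‖y‖ₑ).elim (fun h => hle _ _ h hy)
          fun h => add_comm ‖x‖ₑ ‖y‖ₑ ▸ hle _ _ h hx
  refine ⟨(Metric.closedBall 0 R).indicator a, ham.indicator hB, ?_⟩
  have hlim0 : Tendsto (fun n => ∫⁻ x in Metric.closedBall 0 R, ‖ballAverage ε (u n) x - a x‖ₑ ^ 2)
      atTop (𝓝 (∫⁻ x in Metric.closedBall (0 : EuclideanSpace ℝ (Fin d)) R, 0)) := by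
    refine tendsto_lintegral_of_dominated_convergence' (fun _ => 4 * K)
      (fun n => ((hAm n).sub ham).enorm.pow_const 2 |>.restrict) (fun n => ?_) ?_ ?_
    · exact Eventually.of_forall fun x => e1 _ _ (hAK n x) (haK x)
    · rw [lintegral_const]
      refine ENNReal.mul_ne_top (by finiteness) ?_
      simpa using measure_closedBall_lt_top.ne
    · refine Eventually.of_forall fun x => ?_
      have : Tendsto (fun n => ballAverage ε (u n) x - a x) atTop (𝓝 0) := by
        simpa using (ha x).sub_const (a x)
      simpa using! ((ENNReal.continuous_pow 2).tendsto _).comp this.enorm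
  rw [lintegral_zero] at hlim0
  have h2 : ∀ n, eLpNorm ((Metric.closedBall 0 R).indicator (ballAverage ε (u n)) -
      (Metric.closedBall 0 R).indicator a) 2 volume =
      (∫⁻ x in Metric.closedBall 0 R, ‖ballAverage ε (u n) x - a x‖ₑ ^ 2) ^ (1 / 2 : ℝ) := by
    intro n
    rw [← Set.indicator_sub', eLpNorm_indicator_eq_eLpNorm_restrict hB,
      eLpNorm_eq_lintegral_rpow_enorm_toReal (by norm_num) (by norm_num)]
    simp
  simp only [h2]
  have := (ENNReal.continuous_rpow_const (y := (1 / 2 : ℝ))).tendsto 0 |>.comp hlim0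
  simpa using! this

/-- **Compactness of `X` in `L²`.** A sequence with bounded mass, Dirichlet integral and
potential energy has a subsequence converging in `L²`. -/
theorem exists_subseq_tendsto_eLpNorm {V : EuclideanSpace ℝ (Fin d) → ℝ}
    (hV : ∀ x, 0 ≤ V x) (hVc : Tendsto V (cocompact (EuclideanSpace ℝ (Fin d))) atTop)
    {u : ℕ → EuclideanSpace ℝ (Fin d) → ℂ} (hu : ∀ n, MemX V (u n)) {C : ℝ}
    (hM : ∀ n, mass (u n) ≤ C) (hD : ∀ n, dirichlet (u n) ≤ C)
    (hP : ∀ n, potentialEnergy V (u n) ≤ C) :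
    ∃ σ : ℕ → ℕ, StrictMono σ ∧ ∃ φ : EuclideanSpace ℝ (Fin d) → ℂ, MemLp φ 2 volume ∧
      Tendsto (fun n => eLpNorm (u (σ n) - φ) 2 volume) atTop (𝓝 0) := by
  have hu2 : ∀ n, MemLp (u n) 2 volume := fun n => (hu n).1.1
  have hb : ∀ n, ∫⁻ x, ‖u n x‖ₑ ^ 2 ≤ ENNReal.ofReal C := fun n => by
    rw [lintegral_enorm_sq_eq (hu2 n)]
    exact ENNReal.ofReal_le_ofReal (hM n)
  have hb' : ∀ n, eLpNorm (u n) 2 volume ≤ ENNReal.ofReal √C := fun n => by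
    have hC0 : 0 ≤ C := (mass_nonneg _).trans (hM n)
    refine eLpNorm_two_le_of_lintegral_le ?_
    rw [← ENNReal.ofReal_pow (by positivity), Real.sq_sqrt hC0]
    exact hb n
  obtain ⟨σ, hσ, hav⟩ := exists_subseq_tendsto_ballAverage hu2 ENNReal.ofReal_ne_top hb'
  refine ⟨σ, hσ, ?_⟩
  have hcau : CauchySeq fun n => (hu2 (σ n)).toLp (u (σ n)) := by
    rw [EMetric.cauchySeq_iff]
    intro η hη
    obtain ⟨δ, hδ, hδη⟩ : ∃ δ : ℝ, 0 < δ ∧ 4 * ENNReal.ofReal δ < η := by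
      obtain ⟨r, hr0, hr⟩ := ENNReal.lt_iff_exists_nnreal_btwn.1 hη
      refine ⟨r / 4, by simpa using hr0, ?_⟩
      rw [← ENNReal.ofReal_ofNat, ← ENNReal.ofReal_mul (by norm_num)]
      simpa [mul_div_cancel₀] using hr
    obtain ⟨ε, hε, R, happ⟩ := exists_eLpNorm_sub_indicator_ballAverage_le hV hVc C hδ
    obtain ⟨w, hwm, hw⟩ := exists_tendsto_indicator_ballAverage (fun n => hu2 (σ n))
      ENNReal.ofReal_ne_top (fun n => hb (σ n)) hε R (hav ε)
    have hB : MeasurableSet (Metric.closedBall (0 : EuclideanSpace ℝ (Fin d)) R) :=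
      Metric.isClosed_closedBall.measurableSet
    obtain ⟨N, hN⟩ := eventually_atTop.1 (hw.eventually_le_const
      (ENNReal.ofReal_pos.2 hδ))
    have close : ∀ n ≥ N, eLpNorm (u (σ n) - w) 2 volume ≤ 2 * ENNReal.ofReal δ := by
      intro n hn
      have hm := (aestronglyMeasurable_ballAverage hε (hu2 (σ n))).indicator hB
      calc eLpNorm (u (σ n) - w) 2 volume
          = eLpNorm ((u (σ n) - (Metric.closedBall 0 R).indicator (ballAverage ε (u (σ n)))) +
              ((Metric.closedBall 0 R).indicator (ballAverage ε (u (σ n))) - w)) 2 volume := by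
            rw [sub_add_sub_cancel]
        _ ≤ _ := eLpNorm_add_le ((hu2 _).1.sub hm) (hm.sub hwm) (by norm_num)
        _ ≤ ENNReal.ofReal δ + ENNReal.ofReal δ :=
            add_le_add (happ _ (hu _) (hD _) (hP _)) (hN n hn)
        _ = 2 * ENNReal.ofReal δ := (two_mul _).symm
    refine ⟨N, fun m hm n hn => lt_of_le_of_lt ?_ hδη⟩
    rw [Lp.edist_toLp_toLp]
    calc eLpNorm (u (σ m) - u (σ n)) 2 volume
        = eLpNorm ((u (σ m) - w) - (u (σ n) - w)) 2 volume := by rw [sub_sub_sub_cancel_right]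
      _ ≤ _ := eLpNorm_sub_le ((hu2 _).1.sub hwm) ((hu2 _).1.sub hwm) (by norm_num)
      _ ≤ 2 * ENNReal.ofReal δ + 2 * ENNReal.ofReal δ := add_le_add (close m hm) (close n hn)
      _ = 4 * ENNReal.ofReal δ := by ring
  obtain ⟨f, hf⟩ := cauchySeq_tendsto_of_complete hcau
  refine ⟨f, Lp.memLp f, ?_⟩
  have := (Lp.tendsto_Lp_iff_tendsto_eLpNorm' _ _).1 hf
  refine this.congr fun n => eLpNorm_congr_ae ?_
  exact (hu2 (σ n)).coeFn_toLp.sub EventuallyEq.rfl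

/-! ### Midpoint inequality and coercivity -/

theorem norm_midpoint_sq {F : Type*} [NormedAddCommGroup F] [InnerProductSpace ℂ F] (x y : F) :
    ‖x + (1 / 2 : ℂ) • (y + (-1 : ℂ) • x)‖ ^ 2 =
      1 / 2 * ‖x‖ ^ 2 + 1 / 2 * ‖y‖ ^ 2 - 1 / 4 * ‖y + (-1 : ℂ) • x‖ ^ 2 := by
  have e1 : x + (1 / 2 : ℂ) • (y + (-1 : ℂ) • x) = (1 / 2 : ℂ) • (x + y) := by
    module
  have e2 : y + (-1 : ℂ) • x = -(x - y) := by module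
  have h := parallelogram_law_with_norm ℂ x y
  rw [e1, e2, norm_smul, norm_neg]
  norm_num
  nlinarith

theorem norm_midpoint_rpow_le {q : ℝ} (hq : 1 ≤ q) (x y : ℂ) :
    ‖x + (1 / 2 : ℂ) • (y + (-1 : ℂ) • x)‖ ^ q ≤ 1 / 2 * ‖x‖ ^ q + 1 / 2 * ‖y‖ ^ q := by
  have e1 : x + (1 / 2 : ℂ) • (y + (-1 : ℂ) • x) = (1 / 2 : ℂ) • x + (1 / 2 : ℂ) • y := by
    module
  have h1 : ‖x + (1 / 2 : ℂ) • (y + (-1 : ℂ) • x)‖ ≤ 1 / 2 * ‖x‖ + 1 / 2 * ‖y‖ := by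
    rw [e1]
    refine (norm_add_le _ _).trans_eq ?_
    simp
  have h2 := (convexOn_rpow hq).2 (norm_nonneg x) (norm_nonneg y)
    (by norm_num : (0 : ℝ) ≤ 1 / 2) (by norm_num : (0 : ℝ) ≤ 1 / 2) (by norm_num)
  exact (Real.rpow_le_rpow (norm_nonneg _) h1 (by linarith)).trans (by simpa using! h2)

/-- The action of a midpoint. Writing the midpoint as `φ + (ψ - φ) / 2`, the parallelogram identity
for the quadratic terms and convexity of the nonlinear term show that only the mass term can
violate convexity, while the Dirichlet integral of the difference is gained. -/
theorem FiniteEnergy.action_midpoint_le {V : EuclideanSpace ℝ (Fin d) → ℝ}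
    (hVm : AEMeasurable V volume) (hV : ∀ x, 0 ≤ V x) {p : ℝ} (hp : 1 < p) (ω : ℝ)
    {φ ψ : EuclideanSpace ℝ (Fin d) → ℂ}
    (hφ : FiniteEnergy V p φ) (hψ : FiniteEnergy V p ψ) :
    action V p ω (φ + (1 / 2 : ℂ) • (ψ + (-1 : ℂ) • φ)) +
        1 / 8 * dirichlet (ψ + (-1 : ℂ) • φ) + ω / 4 * mass (ψ + (-1 : ℂ) • φ) ≤
      1 / 2 * action V p ω φ + 1 / 2 * action V p ω ψ := by
  have he : FiniteEnergy V p (ψ + (-1 : ℂ) • φ) := hψ.add_smul hVm hV hφ (-1)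
  have hm := hφ.add_smul hVm hV he (1 / 2)
  have e1 := hψ.1.1.weakGrad_add_smul hφ.1.1 (-1)
  have e2 := hφ.1.1.weakGrad_add_smul he.1.1 (1 / 2)
  have hD : dirichlet (φ + (1 / 2 : ℂ) • (ψ + (-1 : ℂ) • φ)) = 1 / 2 * dirichlet φ +
      1 / 2 * dirichlet ψ - 1 / 4 * dirichlet (ψ + (-1 : ℂ) • φ) := by
    simp only [dirichlet, ← integral_const_mul]
    rw [← integral_add (hφ.integrable_dirichlet.const_mul _) (hψ.integrable_dirichlet.const_mul _),
      ← integral_sub ((hφ.integrable_dirichlet.const_mul _).fun_add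
        (hψ.integrable_dirichlet.const_mul _)) (he.integrable_dirichlet.const_mul _)]
    refine integral_congr_ae ?_
    filter_upwards [e1, e2] with x h1 h2
    rw [h2, Pi.add_apply, Pi.smul_apply, h1]
    exact norm_midpoint_sq _ _
  have hM : mass (φ + (1 / 2 : ℂ) • (ψ + (-1 : ℂ) • φ)) = 1 / 2 * mass φ +
      1 / 2 * mass ψ - 1 / 4 * mass (ψ + (-1 : ℂ) • φ) := by
    simp only [mass, ← integral_const_mul]
    rw [← integral_add (hφ.integrable_mass.const_mul _) (hψ.integrable_mass.const_mul _),
      ← integral_sub ((hφ.integrable_mass.const_mul _).fun_add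
        (hψ.integrable_mass.const_mul _)) (he.integrable_mass.const_mul _)]
    exact integral_congr_ae (Eventually.of_forall fun x => norm_midpoint_sq (φ x) (ψ x))
  have hP : potentialEnergy V (φ + (1 / 2 : ℂ) • (ψ + (-1 : ℂ) • φ)) ≤
      1 / 2 * potentialEnergy V φ + 1 / 2 * potentialEnergy V ψ := by
    simp only [potentialEnergy, ← integral_const_mul]
    rw [← integral_add (hφ.1.2.const_mul _) (hψ.1.2.const_mul _)]
    refine integral_mono hm.1.2 ((hφ.1.2.const_mul _).fun_add (hψ.1.2.const_mul _)) fun x => ?_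
    have h1 := norm_midpoint_sq (φ x) (ψ x)
    have h2 : ‖φ x + (1 / 2 : ℂ) • (ψ x + (-1 : ℂ) • φ x)‖ ^ 2 ≤
        1 / 2 * ‖φ x‖ ^ 2 + 1 / 2 * ‖ψ x‖ ^ 2 := by
      rw [h1]; linarith [sq_nonneg ‖ψ x + (-1 : ℂ) • φ x‖]
    exact (mul_le_mul_of_nonneg_left h2 (hV x)).trans_eq (by ring)
  have hN : powerIntegral p (φ + (1 / 2 : ℂ) • (ψ + (-1 : ℂ) • φ)) ≤
      1 / 2 * powerIntegral p φ + 1 / 2 * powerIntegral p ψ := by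
    simp only [powerIntegral, ← integral_const_mul]
    rw [← integral_add ((hφ.integrable_power hp).const_mul _)
      ((hψ.integrable_power hp).const_mul _)]
    exact integral_mono (hm.integrable_power hp) (((hφ.integrable_power hp).const_mul _).fun_add
      ((hψ.integrable_power hp).const_mul _))
      fun x => norm_midpoint_rpow_le (by linarith) (φ x) (ψ x)
  rw [hm.action_eq, hφ.action_eq, hψ.action_eq, hD, hM]
  have hc : 0 ≤ 2 / (p + 1) := by positivity
  nlinarith [mul_le_mul_of_nonneg_left hN hc]

theorem exists_mul_sq_le_rpow_add {p : ℝ} (hp : 1 < p) (K : ℝ) :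
    ∃ C : ℝ, 0 ≤ C ∧ ∀ s : ℝ, 0 ≤ s → K * s ^ 2 ≤ 2 / (p + 1) * s ^ (p + 1) + C := by
  have hc : 0 < 2 / (p + 1) := by positivity
  -- beyond `s₀` the power of degree `p + 1` dominates
  set s₀ : ℝ := (|K| / (2 / (p + 1))) ^ (p - 1)⁻¹ with hs₀
  have hs₀0 : 0 ≤ s₀ := by positivity
  refine ⟨|K| * s₀ ^ 2, by positivity, fun s hs => ?_⟩
  have hK := le_abs_self K
  rcases le_total s₀ s with h | h
  · have h1 : |K| / (2 / (p + 1)) ≤ s ^ (p - 1) := by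
      calc |K| / (2 / (p + 1)) = s₀ ^ (p - 1) := by
            rw [hs₀, Real.rpow_inv_rpow (by positivity) (by linarith)]
        _ ≤ s ^ (p - 1) := Real.rpow_le_rpow hs₀0 h (by linarith)
    have h2 : s ^ (p + 1) = s ^ (p - 1) * s ^ 2 := by
      rw [← Real.rpow_natCast, ← Real.rpow_add_of_nonneg hs (by linarith) (by norm_num)]
      congr 1; push_cast; ring
    rw [div_le_iff₀ hc] at h1
    have h3 : K * s ^ 2 ≤ s ^ (p - 1) * (2 / (p + 1)) * s ^ 2 := by
      gcongr; exact hK.trans h1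
    rw [h2]
    have : 0 ≤ |K| * s₀ ^ 2 := by positivity
    linarith
  · have h1 : K * s ^ 2 ≤ |K| * s₀ ^ 2 := by gcongr
    have : 0 ≤ 2 / (p + 1) * s ^ (p + 1) := by positivity
    linarith

/-- Coercivity of the action: outside a large ball the potential absorbs the mass term, inside it
the defocusing nonlinearity does. -/
theorem exists_le_action {V : EuclideanSpace ℝ (Fin d) → ℝ} (hV : ∀ x, 0 ≤ V x)
    (hVc : Tendsto V (cocompact (EuclideanSpace ℝ (Fin d))) atTop) {p : ℝ} (hp : 1 < p) (ω : ℝ) :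
    ∃ C : ℝ, ∀ φ : EuclideanSpace ℝ (Fin d) → ℂ, FiniteEnergy V p φ →
      1 / 2 * dirichlet φ + 1 / 2 * potentialEnergy V φ + mass φ ≤ action V p ω φ + C := by
  obtain ⟨R, hR⟩ := exists_closedBall_le hVc (2 * (1 - ω))
  obtain ⟨C, hC, hCs⟩ := exists_mul_sq_le_rpow_add hp (1 - ω)
  have hB : MeasurableSet (Metric.closedBall (0 : EuclideanSpace ℝ (Fin d)) R) :=
    Metric.isClosed_closedBall.measurableSet
  refine ⟨∫ x, (Metric.closedBall (0 : EuclideanSpace ℝ (Fin d)) R).indicator (fun _ => C) x,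
    fun φ hφ => ?_⟩
  have hI : Integrable ((Metric.closedBall (0 : EuclideanSpace ℝ (Fin d)) R).indicator
      (fun _ => C)) volume :=
    (integrable_indicator_iff hB).2 (integrableOn_const measure_closedBall_lt_top.ne)
  have hint : ∫ x, (1 - ω) * ‖φ x‖ ^ 2 ≤ ∫ x, (1 / 2 * (V x * ‖φ x‖ ^ 2) +
      2 / (p + 1) * ‖φ x‖ ^ (p + 1) +
      (Metric.closedBall (0 : EuclideanSpace ℝ (Fin d)) R).indicator (fun _ => C) x) := by
    refine integral_mono (hφ.integrable_mass.const_mul _)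
      (((hφ.1.2.const_mul _).fun_add ((hφ.integrable_power hp).const_mul _)).add hI) fun x => ?_
    have h1 := hCs ‖φ x‖ (norm_nonneg _)
    have h2 : 0 ≤ 2 / (p + 1) * ‖φ x‖ ^ (p + 1) := by positivity
    by_cases hx : x ∈ Metric.closedBall (0 : EuclideanSpace ℝ (Fin d)) R
    · simp only [Set.indicator_of_mem hx]
      have := mul_nonneg (hV x) (sq_nonneg ‖φ x‖)
      linarith
    · simp only [Set.indicator_of_notMem hx]
      have := mul_le_mul_of_nonneg_right (hR x hx) (sq_nonneg ‖φ x‖)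
      linarith
  rw [integral_add ((hφ.1.2.const_mul _).fun_add ((hφ.integrable_power hp).const_mul _)) hI,
    integral_add (hφ.1.2.const_mul _) ((hφ.integrable_power hp).const_mul _),
    integral_const_mul, integral_const_mul, integral_const_mul] at hint
  rw [hφ.action_eq]
  simp only [potentialEnergy, powerIntegral, mass]
  linarith

/-! ### Existence of a minimizer -/

section Convergence

variable {α F : Type*} [MeasurableSpace α] {μ : Measure α} [NormedAddCommGroup F]

theorem integral_norm_sq_eq_norm_toLp {f : α → F} (hf : MemLp f 2 μ) :
    ∫ x, ‖f x‖ ^ 2 ∂μ = ‖hf.toLp f‖ ^ 2 := by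
  have h1 : eLpNorm f 2 μ ^ 2 = ENNReal.ofReal (∫ x, ‖f x‖ ^ 2 ∂μ) := by
    rw [← lintegral_enorm_sq_eq hf,
      eLpNorm_eq_lintegral_rpow_enorm_toReal (by norm_num) (by norm_num),
      ← ENNReal.rpow_natCast, ← ENNReal.rpow_mul]
    simp
  rw [Lp.norm_toLp, ← ENNReal.toReal_pow, h1,
    ENNReal.toReal_ofReal (integral_nonneg fun _ => by positivity)]

theorem tendsto_integral_norm_sq {f : ℕ → α → F} {g : α → F} (hf : ∀ n, MemLp (f n) 2 μ)
    (hg : MemLp g 2 μ) (h : Tendsto (fun n => eLpNorm (f n - g) 2 μ) atTop (𝓝 0)) :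
    Tendsto (fun n => ∫ x, ‖f n x‖ ^ 2 ∂μ) atTop (𝓝 (∫ x, ‖g x‖ ^ 2 ∂μ)) := by
  simp only [integral_norm_sq_eq_norm_toLp (hf _), integral_norm_sq_eq_norm_toLp hg]
  exact (((Lp.tendsto_Lp_iff_tendsto_eLpNorm'' f hf g hg).2 h).norm).pow 2

theorem tendsto_integral_smul {f : ℕ → α → ℂ} {g : α → ℂ} {η : α → ℝ}
    (hf : ∀ n, MemLp (f n) 2 μ)
    (hg : MemLp g 2 μ) (hη : MemLp η 2 μ)
    (h : Tendsto (fun n => eLpNorm (f n - g) 2 μ) atTop (𝓝 0)) :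
    Tendsto (fun n => ∫ x, η x • f n x ∂μ) atTop (𝓝 (∫ x, η x • g x ∂μ)) := by
  refine tendsto_integral_of_L1' _ (integrable_smul_of_memLp_two hη hg).1
    (Eventually.of_forall fun n => integrable_smul_of_memLp_two hη (hf n)) ?_
  have hup : Tendsto (fun n => eLpNorm η 2 μ * eLpNorm (f n - g) 2 μ) atTop (𝓝 0) := by
    simpa using ENNReal.Tendsto.const_mul h (Or.inr hη.2.ne)
  refine tendsto_of_tendsto_of_tendsto_of_le_of_le tendsto_const_nhds hup
    (fun _ => zero_le) fun n => ?_
  have e : ((fun x => η x • f n x) - fun x => η x • g x) = η • (f n - g) := by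
    ext x; simp [mul_sub]
  rw [e]
  exact eLpNorm_smul_le_mul_eLpNorm ((hf n).1.sub hg.1) hη.1

/-- Fatou's lemma for Bochner integrals. -/
theorem integrable_and_integral_le_of_tendsto {f : ℕ → α → ℝ} {g : α → ℝ} {c : ℝ}
    (hf : ∀ n, Integrable (f n) μ) (hf0 : ∀ n x, 0 ≤ f n x)
    (hae : ∀ᵐ x ∂μ, Tendsto (fun n => f n x) atTop (𝓝 (g x)))
    (hc : Tendsto (fun n => ∫ x, f n x ∂μ) atTop (𝓝 c)) :
    Integrable g μ ∧ ∫ x, g x ∂μ ≤ c := by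
  have hg0 : 0 ≤ᵐ[μ] g := by
    filter_upwards [hae] with x hx
    exact ge_of_tendsto' hx fun n => hf0 n x
  have hgm : AEStronglyMeasurable g μ := aestronglyMeasurable_of_tendsto_ae atTop
    (fun n => (hf n).1) hae
  have hle : ∫⁻ x, ENNReal.ofReal (g x) ∂μ ≤ ENNReal.ofReal c := by
    calc ∫⁻ x, ENNReal.ofReal (g x) ∂μ
        = ∫⁻ x, liminf (fun n => ENNReal.ofReal (f n x)) atTop ∂μ := by
          refine lintegral_congr_ae ?_
          filter_upwards [hae] with x hx
          exact ((ENNReal.continuous_ofReal.tendsto _).comp hx).liminf_eq.symm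
      _ ≤ liminf (fun n => ∫⁻ x, ENNReal.ofReal (f n x) ∂μ) atTop :=
          lintegral_liminf_le' fun n => (hf n).1.aemeasurable.ennreal_ofReal
      _ = ENNReal.ofReal c := by
          simp only [← ofReal_integral_eq_lintegral_ofReal (hf _)
            (Eventually.of_forall (hf0 _))]
          exact ((ENNReal.continuous_ofReal.tendsto _).comp hc).liminf_eq
  have hc0 : 0 ≤ c := ge_of_tendsto' hc fun n => integral_nonneg (hf0 n)
  refine ⟨⟨hgm, ?_⟩, ?_⟩
  · rw [hasFiniteIntegral_iff_ofReal hg0]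
    exact hle.trans_lt ENNReal.ofReal_lt_top
  · rw [integral_eq_lintegral_of_nonneg_ae hg0 hgm]
    exact ENNReal.toReal_le_of_le_ofReal hc0 hle

end Convergence

/-- The weak gradient is a closed operator in `L²`. -/
theorem IsWeakGrad.of_tendsto {u : ℕ → EuclideanSpace ℝ (Fin d) → ℂ}
    {g : ℕ → EuclideanSpace ℝ (Fin d) → EuclideanSpace ℂ (Fin d)}
    {φ : EuclideanSpace ℝ (Fin d) → ℂ} {G : EuclideanSpace ℝ (Fin d) → EuclideanSpace ℂ (Fin d)}
    (hu : ∀ n, MemLp (u n) 2 volume) (hg : ∀ n, MemLp (g n) 2 volume)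
    (hug : ∀ n, IsWeakGrad (u n) (g n)) (hφ : MemLp φ 2 volume) (hG : MemLp G 2 volume)
    (h1 : Tendsto (fun n => eLpNorm (u n - φ) 2 volume) atTop (𝓝 0))
    (h2 : Tendsto (fun n => eLpNorm (g n - G) 2 volume) atTop (𝓝 0)) : IsWeakGrad φ G := by
  refine ⟨hφ.locallyIntegrable (by norm_num), hG.locallyIntegrable (by norm_num),
    fun η hη hc i => ?_⟩
  have hη2 : MemLp η 2 volume := hη.continuous.memLp_of_hasCompactSupport hc
  have hη'2 : MemLp (fun x => fderiv ℝ η x (EuclideanSpace.single i 1)) 2 volume :=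
    ((hη.continuous_fderiv (by simp)).clm_apply continuous_const).memLp_of_hasCompactSupport
      (hc.fderiv_apply ℝ _)
  have hcoord : ∀ {k : EuclideanSpace ℝ (Fin d) → EuclideanSpace ℂ (Fin d)},
      MemLp k 2 volume → MemLp (fun x => k x i) 2 volume := fun hk =>
    (EuclideanSpace.proj (𝕜 := ℂ) i).comp_memLp' hk
  have h3 : Tendsto (fun n => eLpNorm ((fun x => g n x i) - fun x => G x i) 2 volume)
      atTop (𝓝 0) := by
    refine tendsto_of_tendsto_of_tendsto_of_le_of_le tendsto_const_nhds h2
      (fun _ => zero_le) fun n => eLpNorm_mono fun x => ?_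
    simpa using PiLp.norm_apply_le (g n x - G x) i
  have l1 := tendsto_integral_smul hu hφ hη'2 h1
  have l2 := (tendsto_integral_smul (fun n => hcoord (hg n)) (hcoord hG) hη2 h3).neg
  refine tendsto_nhds_unique l1 (l2.congr fun n => ?_)
  exact ((hug n).2.2 η hη hc i).symm

/-- A sequence of finite energy functions that converges in `L²` and minimizes the action has
weak gradients that form a Cauchy sequence in `L²`: the action of the midpoint of two members is at
least the infimum. -/
theorem cauchySeq_weakGrad_of_minimizing {V : EuclideanSpace ℝ (Fin d) → ℝ}
    (hVm : AEMeasurable V volume) (hV : ∀ x, 0 ≤ V x) {p : ℝ} (hp : 1 < p) {ω I : ℝ}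
    (hI : ∀ ψ : EuclideanSpace ℝ (Fin d) → ℂ, FiniteEnergy V p ψ → I ≤ action V p ω ψ)
    {u : ℕ → EuclideanSpace ℝ (Fin d) → ℂ} (hu : ∀ n, FiniteEnergy V p (u n))
    (hS : Tendsto (fun n => action V p ω (u n)) atTop (𝓝 I))
    (hc : CauchySeq fun n => (hu n).1.1.1.toLp (u n)) :
    CauchySeq fun n => (hu n).1.1.memLp_weakGrad.toLp (weakGrad (u n)) := by
  have hM : ∀ m n, mass (u n + (-1 : ℂ) • u m) =
      dist ((hu m).1.1.1.toLp (u m)) ((hu n).1.1.1.toLp (u n)) ^ 2 := by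
    intro m n
    rw [dist_comm, dist_eq_norm, ← MemLp.toLp_sub, ← integral_norm_sq_eq_norm_toLp]
    refine integral_congr_ae (Eventually.of_forall fun x => ?_)
    simp [sub_eq_add_neg]
  have hD : ∀ m n, dirichlet (u n + (-1 : ℂ) • u m) =
      dist ((hu m).1.1.memLp_weakGrad.toLp (weakGrad (u m)))
        ((hu n).1.1.memLp_weakGrad.toLp (weakGrad (u n))) ^ 2 := by
    intro m n
    rw [dist_comm, dist_eq_norm, ← MemLp.toLp_sub, ← integral_norm_sq_eq_norm_toLp]
    refine integral_congr_ae ?_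
    filter_upwards [(hu n).1.1.weakGrad_add_smul (hu m).1.1 (-1)] with x hx
    rw [hx]
    simp [sub_eq_add_neg]
  rw [cauchySeq_iff_tendsto_dist_atTop_0, ← prod_atTop_atTop_eq] at hc ⊢
  have hS1 := hS.comp (tendsto_fst (f := (atTop : Filter ℕ)) (g := (atTop : Filter ℕ)))
  have hS2 := hS.comp (tendsto_snd (f := (atTop : Filter ℕ)) (g := (atTop : Filter ℕ)))
  have hup := ((((hS1.sub_const I).const_mul 4).add ((hS2.sub_const I).const_mul 4)).add
    ((hc.pow 2).const_mul (-(2 * ω)))).sqrt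
  simp only [sub_self, mul_zero, add_zero, ne_eq, OfNat.ofNat_ne_zero, not_false_eq_true, zero_pow,
    Real.sqrt_zero] at hup
  refine squeeze_zero (fun _ => dist_nonneg) (fun z => ?_) hup
  refine Real.le_sqrt_of_sq_le ?_
  have h1 := (hu z.1).action_midpoint_le hVm hV hp ω (hu z.2)
  have h2 := hI _ ((hu z.1).add_smul hVm hV ((hu z.2).add_smul hVm hV (hu z.1) (-1)) (1 / 2))
  rw [hM, hD] at h1
  simp only [Function.comp_apply]
  linarith

/-- The action attains its infimum over the functions of finite energy. Along a minimizing sequence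
that converges in `L²`, the mass and the Dirichlet integral converge to those of the limit, and the
potential and nonlinear terms are lower semicontinuous. -/
theorem exists_isMinOn_action {V : EuclideanSpace ℝ (Fin d) → ℝ}
    (hVm : AEMeasurable V volume) (hV : ∀ x, 0 ≤ V x)
    (hVc : Tendsto V (cocompact (EuclideanSpace ℝ (Fin d))) atTop) {p : ℝ} (hp : 1 < p) (ω : ℝ)
    (hne : ∃ φ : EuclideanSpace ℝ (Fin d) → ℂ, FiniteEnergy V p φ) :
    ∃ φ : EuclideanSpace ℝ (Fin d) → ℂ, FiniteEnergy V p φ ∧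
      ∀ ψ, FiniteEnergy V p ψ → action V p ω φ ≤ action V p ω ψ := by
  obtain ⟨C, hC⟩ := exists_le_action hV hVc hp ω
  set A : Set ℝ := action V p ω '' {φ | FiniteEnergy V p φ}
  have hAb : BddBelow A := by
    refine ⟨-C, ?_⟩
    rintro _ ⟨φ, hφ, rfl⟩
    have := hC φ hφ
    linarith [dirichlet_nonneg φ, potentialEnergy_nonneg hV φ, mass_nonneg φ]
  have hI : ∀ ψ : EuclideanSpace ℝ (Fin d) → ℂ, FiniteEnergy V p ψ →
      sInf A ≤ action V p ω ψ := fun ψ hψ => csInf_le hAb ⟨ψ, hψ, rfl⟩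
  obtain ⟨s, -, hs, hsA⟩ := exists_seq_tendsto_sInf
    (Set.Nonempty.image (action V p ω) hne) hAb
  choose u hu hus using hsA
  obtain rfl : (fun n => action V p ω (u n)) = s := funext hus
  obtain ⟨B, hB⟩ := hs.bddAbove_range
  have hSB : ∀ n, action V p ω (u n) ≤ B := fun n => hB ⟨n, rfl⟩
  have hbound := fun n => hC (u n) (hu n)
  have hD0 := fun n => dirichlet_nonneg (u n)
  have hP0 := fun n => potentialEnergy_nonneg hV (u n)
  have hM0 := fun n => mass_nonneg (u n)
  obtain ⟨σ, hσ, φ, hφ2, hφlim⟩ := exists_subseq_tendsto_eLpNorm hV hVc (fun n => (hu n).1)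
    (C := 2 * (B + C))
    (fun n => by linarith [hSB n, hbound n, hD0 n, hP0 n, hM0 n])
    (fun n => by linarith [hSB n, hbound n, hD0 n, hP0 n, hM0 n])
    (fun n => by linarith [hSB n, hbound n, hD0 n, hP0 n, hM0 n])
  obtain ⟨τ, hτ, hae⟩ := (tendstoInMeasure_of_tendsto_eLpNorm (by norm_num)
    (fun n => (hu (σ n)).1.1.1.1) hφ2.1 hφlim).exists_seq_tendsto_ae
  -- pass to the subsequence `v`, which converges in `L²` and almost everywhere
  obtain ⟨v, hvdef⟩ : ∃ v : ℕ → EuclideanSpace ℝ (Fin d) → ℂ, v = fun n => u (σ (τ n)) := ⟨_, rfl⟩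
  have hv : ∀ n, FiniteEnergy V p (v n) := fun n => by rw [hvdef]; exact hu _
  have hvS : Tendsto (fun n => action V p ω (v n)) atTop (𝓝 (sInf A)) := by
    rw [hvdef]
    exact hs.comp (hσ.tendsto_atTop.comp hτ.tendsto_atTop)
  have hvlim : Tendsto (fun n => eLpNorm (v n - φ) 2 volume) atTop (𝓝 0) := by
    rw [hvdef]
    exact hφlim.comp hτ.tendsto_atTop
  have hvae : ∀ᵐ x, Tendsto (fun n => v n x) atTop (𝓝 (φ x)) := by
    rw [hvdef]
    exact hae
  have hcau := cauchySeq_weakGrad_of_minimizing hVm hV hp hI hv hvS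
    ((Lp.tendsto_Lp_iff_tendsto_eLpNorm'' v (fun n => (hv n).1.1.1) φ hφ2).2 hvlim).cauchySeq
  obtain ⟨G, hG⟩ := cauchySeq_tendsto_of_complete hcau
  have hG2 : MemLp G 2 volume := Lp.memLp G
  have hGlim : Tendsto (fun n => eLpNorm (weakGrad (v n) - ⇑G) 2 volume) atTop (𝓝 0) := by
    refine ((Lp.tendsto_Lp_iff_tendsto_eLpNorm' _ _).1 hG).congr fun n => eLpNorm_congr_ae ?_
    exact (hv n).1.1.memLp_weakGrad.coeFn_toLp.sub EventuallyEq.rfl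
  have hgrad : IsWeakGrad φ G := IsWeakGrad.of_tendsto (fun n => (hv n).1.1.1)
    (fun n => (hv n).1.1.memLp_weakGrad) (fun n => (hv n).1.1.isWeakGrad) hφ2 hG2 hvlim hGlim
  have hφH1 : MemH1 φ := ⟨hφ2, G, hG2, hgrad⟩
  have hMlim : Tendsto (fun n => mass (v n)) atTop (𝓝 (mass φ)) :=
    tendsto_integral_norm_sq (fun n => (hv n).1.1.1) hφ2 hvlim
  have hDlim : Tendsto (fun n => dirichlet (v n)) atTop (𝓝 (dirichlet φ)) := by
    have e : dirichlet φ = ∫ x, ‖G x‖ ^ 2 := integral_congr_ae <| by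
      filter_upwards [hgrad.weakGrad_ae_eq] with x hx
      rw [hx]
    rw [e]
    exact tendsto_integral_norm_sq (fun n => (hv n).1.1.memLp_weakGrad) hG2 hGlim
  have hc0 : 0 < 2 / (p + 1) := by positivity
  have hVn : ∀ (ψ : EuclideanSpace ℝ (Fin d) → ℂ) x, 0 ≤ V x * ‖ψ x‖ ^ 2 := fun ψ x =>
    mul_nonneg (hV x) (by positivity)
  have hNn : ∀ (ψ : EuclideanSpace ℝ (Fin d) → ℂ) x, 0 ≤ 2 / (p + 1) * ‖ψ x‖ ^ (p + 1) :=
    fun ψ x => by positivity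
  -- Fatou's lemma for the remaining, nonnegative, part of the action density
  obtain ⟨hQi, hQ⟩ := integrable_and_integral_le_of_tendsto (μ := volume)
    (f := fun n x => V x * ‖v n x‖ ^ 2 + 2 / (p + 1) * ‖v n x‖ ^ (p + 1))
    (g := fun x => V x * ‖φ x‖ ^ 2 + 2 / (p + 1) * ‖φ x‖ ^ (p + 1))
    (c := sInf A - 1 / 2 * dirichlet φ - ω * mass φ)
    (fun n => (hv n).1.2.add (((hv n).integrable_power hp).const_mul _))
    (fun n x => add_nonneg (hVn _ x) (hNn _ x))
    (by
      filter_upwards [hvae] with x hx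
      exact ((hx.norm.pow 2).const_mul _).add
        ((hx.norm.rpow_const (Or.inr (by linarith))).const_mul _))
    (((hvS.sub (hDlim.const_mul _)).sub (hMlim.const_mul _)).congr fun n => by
      rw [integral_add (hv n).1.2 (((hv n).integrable_power hp).const_mul _), integral_const_mul,
        (hv n).action_eq, potentialEnergy, powerIntegral]
      ring)
  have hφV : Integrable (fun x => V x * ‖φ x‖ ^ 2) volume :=
    hQi.mono' (hVm.aestronglyMeasurable.mul (hφ2.1.norm.pow 2)) (Eventually.of_forall fun x => by
      rw [Real.norm_of_nonneg (hVn φ x)]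
      exact le_add_of_nonneg_right (hNn φ x))
  have hφN : Integrable (fun x => ‖φ x‖ ^ (p + 1)) volume := by
    have : Integrable (fun x => 2 / (p + 1) * ‖φ x‖ ^ (p + 1)) volume := by
      refine (hQi.sub hφV).congr (Eventually.of_forall fun x => ?_)
      simp
    refine (this.const_mul (2 / (p + 1))⁻¹).congr (Eventually.of_forall fun x => ?_)
    exact inv_mul_cancel_left₀ hc0.ne' _
  have hφ : FiniteEnergy V p φ := by
    refine ⟨⟨hφH1, hφV⟩, ?_⟩
    rw [← integrable_norm_rpow_iff hφ2.1 (by simp; linarith) (by simp),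
      ENNReal.toReal_ofReal (by linarith)]
    exact hφN
  refine ⟨φ, hφ, fun ψ hψ => le_trans ?_ (hI ψ hψ)⟩
  rw [integral_add hφV (hφN.const_mul _), integral_const_mul] at hQ
  rw [hφ.action_eq, potentialEnergy, powerIntegral]
  linarith

/-! ### The first variation of the action -/

theorem integrable_inner_of_memLp_two {α F : Type*} [MeasurableSpace α] {μ : Measure α}
    [NormedAddCommGroup F] [InnerProductSpace ℂ F] {f g : α → F} (hf : MemLp f 2 μ)
    (hg : MemLp g 2 μ) : Integrable (fun x => inner ℂ (f x) (g x)) μ := by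
  refine (integrable_congr ?_).1 (L2.integrable_inner (𝕜 := ℂ) (hf.toLp f) (hg.toLp g))
  filter_upwards [hf.coeFn_toLp, hg.coeFn_toLp] with x h1 h2
  rw [h1, h2]

theorem hasDerivAt_integral_norm_add_smul_sq {α F : Type*} [MeasurableSpace α] {μ : Measure α}
    [NormedAddCommGroup F] [InnerProductSpace ℂ F] {f g : α → F} (hf : MemLp f 2 μ)
    (hg : MemLp g 2 μ) :
    HasDerivAt (fun t : ℝ => ∫ x, ‖f x + (t : ℂ) • g x‖ ^ 2 ∂μ)
      (2 * (∫ x, inner ℂ (g x) (f x) ∂μ).re) 0 := by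
  have hI := integrable_inner_of_memLp_two hg hf
  have hf2 := (memLp_two_iff_integrable_sq_norm hf.1).1 hf
  have hg2 := (memLp_two_iff_integrable_sq_norm hg.1).1 hg
  have hre : Integrable (fun x => (inner ℂ (g x) (f x)).re) μ := hI.re
  have e : ∀ t : ℝ, ∫ x, ‖f x + (t : ℂ) • g x‖ ^ 2 ∂μ = ∫ x, ‖f x‖ ^ 2 ∂μ +
      t * (2 * (∫ x, inner ℂ (g x) (f x) ∂μ).re) + t ^ 2 * ∫ x, ‖g x‖ ^ 2 ∂μ := by
    intro t
    have hre' : (∫ x, inner ℂ (g x) (f x) ∂μ).re = ∫ x, (inner ℂ (g x) (f x)).re ∂μ :=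
      (integral_re hI).symm
    rw [hre', ← integral_const_mul, ← integral_const_mul, ← integral_const_mul,
      ← integral_add hf2 ((hre.const_mul 2).const_mul t),
      ← integral_add (hf2.fun_add ((hre.const_mul 2).const_mul t)) (hg2.const_mul _)]
    refine integral_congr_ae (Eventually.of_forall fun x => ?_)
    have h1 := norm_add_sq (𝕜 := ℂ) (f x) ((t : ℂ) • g x)
    have h2 : (inner ℂ (g x) (f x)).re = (inner ℂ (f x) (g x)).re := inner_re_symm (𝕜 := ℂ) _ _
    rw [inner_smul_right, norm_smul, mul_pow, Complex.norm_real, Real.norm_eq_abs, sq_abs,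
      RCLike.re_eq_complex_re, Complex.re_ofReal_mul] at h1
    simp only [h1, h2]
    ring
  simp only [e]
  have h1 := ((hasDerivAt_id (0 : ℝ)).mul_const
    (2 * (∫ x, inner ℂ (g x) (f x) ∂μ).re)).const_add (∫ x, ‖f x‖ ^ 2 ∂μ)
  have h2 := ((hasDerivAt_id (0 : ℝ)).pow 2).mul_const (∫ x, ‖g x‖ ^ 2 ∂μ)
  simpa using! h1.add h2

section Power

variable {α : Type*} [MeasurableSpace α] {μ : Measure α} {p : ℝ} {f g : α → ℂ}

theorem integrable_norm_add_norm_rpow (hp : 1 < p) (hf : MemLp f (ENNReal.ofReal (p + 1)) μ)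
    (hg : MemLp g (ENNReal.ofReal (p + 1)) μ) :
    Integrable (fun x => (‖f x‖ + ‖g x‖) ^ (p + 1)) μ := by
  have := (hf.norm.add hg.norm).integrable_norm_rpow (by simp; linarith) (by simp)
  rw [ENNReal.toReal_ofReal (by linarith)] at this
  refine this.congr (Eventually.of_forall fun x => ?_)
  simp [abs_of_nonneg (add_nonneg (norm_nonneg (f x)) (norm_nonneg (g x)))]

theorem rpow_mul_mul_le {p a b m : ℝ} (hp : 1 < p) (ha : 0 ≤ a) (hb : 0 ≤ b) (ham : a ≤ m)
    (hbm : b ≤ m) : a ^ (p - 1) * (a * b) ≤ m ^ (p + 1) := by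
  have hm : 0 ≤ m := ha.trans ham
  calc a ^ (p - 1) * (a * b) ≤ m ^ (p - 1) * (m * m) := by
        gcongr
    _ = m ^ (p + 1) := by
        rw [← sq, ← Real.rpow_natCast, ← Real.rpow_add_of_nonneg hm (by linarith) (by norm_num)]
        congr 1; push_cast; ring

theorem integrable_rpow_mul_mul_star (hp : 1 < p) (hf : MemLp f (ENNReal.ofReal (p + 1)) μ)
    (hg : MemLp g (ENNReal.ofReal (p + 1)) μ) :
    Integrable (fun x => ((‖f x‖ ^ (p - 1) : ℝ) : ℂ) * (f x * star (g x))) μ := by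
  refine (integrable_norm_add_norm_rpow hp hf hg).mono' ?_ (Eventually.of_forall fun x => ?_)
  · exact (Complex.continuous_ofReal.comp_aestronglyMeasurable
      (hf.1.norm.aemeasurable.pow_const _).aestronglyMeasurable).mul (hf.1.mul hg.1.star)
  · rw [norm_mul, norm_mul, norm_star, Complex.norm_real, Real.norm_of_nonneg (by positivity)]
    exact rpow_mul_mul_le hp (norm_nonneg _) (norm_nonneg _)
      (le_add_of_nonneg_right (norm_nonneg _)) (le_add_of_nonneg_left (norm_nonneg _))

/-- Differentiation under the integral sign, with the derivatives at parameters `|t| ≤ 1` dominated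
by `(p + 1) (‖f‖ + ‖g‖) ^ (p + 1)`. -/
theorem hasDerivAt_integral_norm_add_smul_rpow (hp : 1 < p)
    (hf : MemLp f (ENNReal.ofReal (p + 1)) μ) (hg : MemLp g (ENNReal.ofReal (p + 1)) μ) :
    HasDerivAt (fun t : ℝ => ∫ x, ‖f x + (t : ℂ) • g x‖ ^ (p + 1) ∂μ)
      ((p + 1) * (∫ x, ((‖f x‖ ^ (p - 1) : ℝ) : ℂ) * (f x * star (g x)) ∂μ).re) 0 := by
  have hI := integrable_rpow_mul_mul_star hp hf hg
  have hmeas : ∀ t : ℝ, MemLp (fun x => f x + (t : ℂ) • g x) (ENNReal.ofReal (p + 1)) μ :=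
    fun t => hf.add (hg.const_smul (t : ℂ))
  have hder : ∀ x (t : ℝ), HasDerivAt (fun t : ℝ => ‖f x + (t : ℂ) • g x‖ ^ (p + 1))
      ((p + 1) * (‖f x + (t : ℂ) • g x‖ ^ (p - 1) * inner ℝ (f x + (t : ℂ) • g x) (g x))) t := by
    intro x t
    have h1 : HasDerivAt (fun t : ℝ => f x + (t : ℂ) • g x) (g x) t := by
      simpa using ((hasDerivAt_id t).ofReal_comp.smul_const (g x)).const_add (f x)
    have h2 := (hasFDerivAt_norm_rpow (f x + (t : ℂ) • g x)
      (by linarith : 1 < p + 1)).comp_hasDerivAt t h1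
    refine h2.congr_deriv ?_
    have : p + 1 - 2 = p - 1 := by ring
    simp only [this, smul_apply, coe_innerSL_apply, smul_eq_mul]
    ring
  have h := hasDerivAt_integral_of_dominated_loc_of_deriv_le (μ := μ) (x₀ := (0 : ℝ))
    (F := fun (t : ℝ) x => ‖f x + (t : ℂ) • g x‖ ^ (p + 1))
    (F' := fun (t : ℝ) x =>
      (p + 1) * (‖f x + (t : ℂ) • g x‖ ^ (p - 1) * inner ℝ (f x + (t : ℂ) • g x) (g x)))
    (bound := fun x => (p + 1) * (‖f x‖ + ‖g x‖) ^ (p + 1))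
    (Metric.ball_mem_nhds 0 one_pos)
    (Eventually.of_forall fun t =>
      ((hmeas t).1.norm.aemeasurable.pow_const _).aestronglyMeasurable)
    (by
      have := (hmeas 0).integrable_norm_rpow (by simp; linarith) (by simp)
      rwa [ENNReal.toReal_ofReal (by linarith)] at this)
    (((((hmeas 0).1.norm.aemeasurable.pow_const _).aestronglyMeasurable).mul
      ((hmeas 0).1.inner hg.1)).const_mul _)
    (Eventually.of_forall fun x t ht => by
      have ht1 : |t| ≤ 1 := by simpa using (mem_ball_zero_iff.1 ht).le
      rw [norm_mul, Real.norm_of_nonneg (by linarith : 0 ≤ p + 1), norm_mul,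
        Real.norm_of_nonneg (by positivity)]
      have hle : ‖f x + (t : ℂ) • g x‖ ≤ ‖f x‖ + ‖g x‖ := by
        refine (norm_add_le _ _).trans ?_
        rw [norm_smul, Complex.norm_real, Real.norm_eq_abs]
        nlinarith [norm_nonneg (g x)]
      gcongr
      refine le_trans ?_ (rpow_mul_mul_le hp (norm_nonneg _) (norm_nonneg (g x)) hle
        (le_add_of_nonneg_left (norm_nonneg _)))
      gcongr
      exact norm_inner_le_norm _ _)
    ((integrable_norm_add_norm_rpow hp hf hg).const_mul _)
    (Eventually.of_forall fun x t _ => hder x t)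
  refine h.2.congr_deriv ?_
  have hre' : (∫ x, ((‖f x‖ ^ (p - 1) : ℝ) : ℂ) * (f x * star (g x)) ∂μ).re =
      ∫ x, (((‖f x‖ ^ (p - 1) : ℝ) : ℂ) * (f x * star (g x))).re ∂μ := (integral_re hI).symm
  rw [hre', ← integral_const_mul]
  refine integral_congr_ae (Eventually.of_forall fun x => ?_)
  have hinner : inner ℝ (f x) (g x) = (f x * star (g x)).re := by
    simp [Complex.inner]
    ring
  simp only [Complex.ofReal_zero, zero_smul, add_zero, Complex.re_ofReal_mul, hinner]

end Power

/-- The left-hand side of the stationary equation for `φ` tested with `v`. It is conjugate linear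
in `v`, and twice its real part is the derivative of the action at `φ` in the direction `v`. -/
def firstVariation (V : EuclideanSpace ℝ (Fin d) → ℝ) (p ω : ℝ)
    (φ v : EuclideanSpace ℝ (Fin d) → ℂ) : ℂ :=
  (1 / 2 : ℂ) * (∫ x, inner ℂ (weakGrad v x) (weakGrad φ x))
    + (∫ x, (V x : ℂ) * (φ x * star (v x)))
    + (∫ x, ((‖φ x‖ ^ (p - 1) : ℝ) : ℂ) * (φ x * star (v x)))
    + (ω : ℂ) * (∫ x, φ x * star (v x))

theorem FiniteEnergy.hasDerivAt_action {V : EuclideanSpace ℝ (Fin d) → ℝ}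
    (hVm : AEMeasurable V volume) (hV : ∀ x, 0 ≤ V x) {p : ℝ} (hp : 1 < p) (ω : ℝ)
    {φ v : EuclideanSpace ℝ (Fin d) → ℂ} (hφ : FiniteEnergy V p φ) (hv : FiniteEnergy V p v) :
    HasDerivAt (fun t : ℝ => action V p ω (φ + (t : ℂ) • v))
      (2 * (firstVariation V p ω φ v).re) 0 := by
  have hD : HasDerivAt (fun t : ℝ => dirichlet (φ + (t : ℂ) • v))
      (2 * (∫ x, inner ℂ (weakGrad v x) (weakGrad φ x)).re) 0 := by
    have e : ∀ t : ℝ, dirichlet (φ + (t : ℂ) • v) =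
        ∫ x, ‖weakGrad φ x + (t : ℂ) • weakGrad v x‖ ^ 2 := fun t => integral_congr_ae <| by
      filter_upwards [hφ.1.1.weakGrad_add_smul hv.1.1 t] with x hx
      rw [hx]; rfl
    simp only [e]
    exact hasDerivAt_integral_norm_add_smul_sq hφ.1.1.memLp_weakGrad hv.1.1.memLp_weakGrad
  have hM : HasDerivAt (fun t : ℝ => mass (φ + (t : ℂ) • v))
      (2 * (∫ x, φ x * star (v x)).re) 0 :=
    hasDerivAt_integral_norm_add_smul_sq hφ.1.1.1 hv.1.1.1
  have hP : HasDerivAt (fun t : ℝ => potentialEnergy V (φ + (t : ℂ) • v))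
      (2 * (∫ x, (V x : ℂ) * (φ x * star (v x))).re) 0 := by
    have e : ∀ t : ℝ, potentialEnergy V (φ + (t : ℂ) • v) =
        ∫ x, ‖(√(V x) : ℂ) * φ x + (t : ℂ) • ((√(V x) : ℂ) * v x)‖ ^ 2 := fun t => by
      refine integral_congr_ae (Eventually.of_forall fun x => ?_)
      have h1 : (√(V x) : ℂ) * φ x + (t : ℂ) • ((√(V x) : ℂ) * v x) =
          (√(V x) : ℂ) * (φ + (t : ℂ) • v) x := by
        simp; ring
      simp only [h1, norm_mul, mul_pow, Complex.norm_real, Real.norm_eq_abs, sq_abs,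
        Real.sq_sqrt (hV x)]
    have e2 : ∀ x, (V x : ℂ) * (φ x * star (v x)) =
        inner ℂ ((√(V x) : ℂ) * v x) ((√(V x) : ℂ) * φ x) := fun x => by
      have h1 : (V x : ℂ) = (√(V x) : ℂ) * (√(V x) : ℂ) := by
        rw [← Complex.ofReal_mul, Real.mul_self_sqrt (hV x)]
      rw [h1]
      simp
      ring
    simp only [e, e2]
    exact hasDerivAt_integral_norm_add_smul_sq
      ((integrable_potential_iff hVm hV hφ.1.1.1.1).1 hφ.1.2)
      ((integrable_potential_iff hVm hV hv.1.1.1.1).1 hv.1.2)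
  have hN : HasDerivAt (fun t : ℝ => powerIntegral p (φ + (t : ℂ) • v))
      ((p + 1) * (∫ x, ((‖φ x‖ ^ (p - 1) : ℝ) : ℂ) * (φ x * star (v x))).re) 0 :=
    hasDerivAt_integral_norm_add_smul_rpow hp hφ.2 hv.2
  have hS := (((hD.const_mul (1 / 2)).add hP).add (hN.const_mul (2 / (p + 1)))).add
    (hM.const_mul ω)
  have e : (fun t : ℝ => action V p ω (φ + (t : ℂ) • v)) = fun t : ℝ =>
      1 / 2 * dirichlet (φ + (t : ℂ) • v) + potentialEnergy V (φ + (t : ℂ) • v) +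
        2 / (p + 1) * powerIntegral p (φ + (t : ℂ) • v) + ω * mass (φ + (t : ℂ) • v) :=
    funext fun t => (hφ.add_smul hVm hV hv t).action_eq ω
  rw [e]
  refine hS.congr_deriv ?_
  have hp1 : p + 1 ≠ 0 := by linarith
  have h2 : (1 / 2 : ℂ) = ((1 / 2 : ℝ) : ℂ) := by norm_num
  simp only [firstVariation, h2, Complex.add_re, Complex.re_ofReal_mul]
  field_simp

/-- The Euler–Lagrange equation: a minimizer of the action over the functions of finite energy is a
critical point. -/
theorem FiniteEnergy.firstVariation_eq_zero {V : EuclideanSpace ℝ (Fin d) → ℝ}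
    (hVm : AEMeasurable V volume) (hV : ∀ x, 0 ≤ V x) {p : ℝ} (hp : 1 < p) {ω : ℝ}
    {φ v : EuclideanSpace ℝ (Fin d) → ℂ} (hφ : FiniteEnergy V p φ)
    (hmin : ∀ ψ, FiniteEnergy V p ψ → action V p ω φ ≤ action V p ω ψ)
    (hv : FiniteEnergy V p v) : firstVariation V p ω φ v = 0 := by
  have hre : ∀ w, FiniteEnergy V p w → (firstVariation V p ω φ w).re = 0 := by
    intro w hw
    have h := hφ.hasDerivAt_action hVm hV hp ω hw
    have hloc : IsLocalMin (fun t : ℝ => action V p ω (φ + (t : ℂ) • w)) 0 :=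
      Eventually.of_forall fun t => by
        simpa using hmin _ (hφ.add_smul hVm hV hw t)
    have := hloc.hasDerivAt_eq_zero h
    linarith
  -- testing with `i v` gives the imaginary part, by conjugate linearity
  have hIv : FiniteEnergy V p (v + (Complex.I - 1) • v) := hv.add_smul hVm hV hv _
  have hfv : firstVariation V p ω φ (v + (Complex.I - 1) • v) =
      -Complex.I * firstVariation V p ω φ v := by
    have hstar : ∀ x, star ((v + (Complex.I - 1) • v) x) = -Complex.I * star (v x) := fun x => by
      have : (v + (Complex.I - 1) • v) x = Complex.I * v x := by simp; ring
      rw [this]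
      simp
    have e1 : ∫ x, inner ℂ (weakGrad (v + (Complex.I - 1) • v) x) (weakGrad φ x) =
        -Complex.I * ∫ x, inner ℂ (weakGrad v x) (weakGrad φ x) := by
      rw [← integral_const_mul]
      refine integral_congr_ae ?_
      filter_upwards [hv.1.1.weakGrad_add_smul hv.1.1 (Complex.I - 1)] with x hx
      have : (weakGrad v + (Complex.I - 1) • weakGrad v) x = Complex.I • weakGrad v x := by
        simp only [Pi.add_apply, Pi.smul_apply]; module
      rw [hx, this, inner_smul_left, Complex.conj_I]
    have e2 : ∀ a : EuclideanSpace ℝ (Fin d) → ℂ,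
        ∫ x, a x * (φ x * star ((v + (Complex.I - 1) • v) x)) =
        -Complex.I * ∫ x, a x * (φ x * star (v x)) := fun a => by
      rw [← integral_const_mul]
      refine integral_congr_ae (Eventually.of_forall fun x => ?_)
      simp only [hstar]
      ring
    have e3 := e2 1
    simp only [Pi.one_apply, one_mul] at e3
    rw [firstVariation, firstVariation, e1, e2, e2, e3]
    ring
  have h1 := hre v hv
  have h2 := hre _ hIv
  rw [hfv] at h2
  refine Complex.ext h1 ?_
  simpa using h2

theorem firstVariation_self (V : EuclideanSpace ℝ (Fin d) → ℝ) {p : ℝ} (hp : 1 < p) (ω : ℝ)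
    (φ : EuclideanSpace ℝ (Fin d) → ℂ) : firstVariation V p ω φ φ =
      ((1 / 2 * dirichlet φ + potentialEnergy V φ + powerIntegral p φ + ω * mass φ : ℝ) : ℂ) := by
  have hsq : ∀ z : ℂ, z * star z = ((‖z‖ ^ 2 : ℝ) : ℂ) := fun z => by
    simp [Complex.mul_conj']
  have e1 : ∫ x, inner ℂ (weakGrad φ x) (weakGrad φ x) = (dirichlet φ : ℂ) := by
    rw [dirichlet, ← integral_complex_ofReal]
    exact integral_congr_ae (Eventually.of_forall fun x => by
      simp [inner_self_eq_norm_sq_to_K])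
  have e2 : ∫ x, (V x : ℂ) * (φ x * star (φ x)) = (potentialEnergy V φ : ℂ) := by
    rw [potentialEnergy, ← integral_complex_ofReal]
    simp only [hsq, Complex.ofReal_mul]
  have e3 : ∫ x, ((‖φ x‖ ^ (p - 1) : ℝ) : ℂ) * (φ x * star (φ x)) = (powerIntegral p φ : ℂ) := by
    rw [powerIntegral, ← integral_complex_ofReal]
    refine integral_congr_ae (Eventually.of_forall fun x => ?_)
    simp only [hsq, ← Complex.ofReal_mul]
    rw [← Real.rpow_natCast ‖φ x‖ 2,
      ← Real.rpow_add_of_nonneg (norm_nonneg _) (by linarith) (by norm_num)]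
    congr 2; push_cast; ring
  have e4 : ∫ x, φ x * star (φ x) = (mass φ : ℂ) := by
    rw [mass, ← integral_complex_ofReal]
    simp only [hsq]
  rw [firstVariation, e1, e2, e3, e4]
  push_cast
  ring

/-! ### Ground states -/

theorem FiniteEnergy.mass_pos {V : EuclideanSpace ℝ (Fin d) → ℝ} {p : ℝ}
    {φ : EuclideanSpace ℝ (Fin d) → ℂ} (hφ : FiniteEnergy V p φ) (h0 : ¬ φ =ᵐ[volume] 0) :
    0 < mass φ := by
  refine (mass_nonneg φ).lt_of_ne' fun h => h0 ?_
  have h1 := (integral_eq_zero_iff_of_nonneg (fun x => by positivity) hφ.integrable_mass).1 h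
  filter_upwards [h1] with x hx
  simpa using hx

theorem FiniteEnergy.powerIntegral_pos {V : EuclideanSpace ℝ (Fin d) → ℝ} {p : ℝ} (hp : 1 < p)
    {φ : EuclideanSpace ℝ (Fin d) → ℂ} (hφ : FiniteEnergy V p φ) (h0 : ¬ φ =ᵐ[volume] 0) :
    0 < powerIntegral p φ := by
  refine (powerIntegral_nonneg p φ).lt_of_ne' fun h => h0 ?_
  have h1 := (integral_eq_zero_iff_of_nonneg (fun x => by positivity) (hφ.integrable_power hp)).1 h
  filter_upwards [h1] with x hx
  have := (Real.rpow_eq_zero (norm_nonneg (φ x)) (by linarith : p + 1 ≠ 0)).1 hx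
  simpa using this

/-- Testing the stationary equation with the solution itself shows that its action is
`(2 / (p + 1) - 1) ‖φ‖_{L^{p+1}}^{p+1}`, which is negative. -/
theorem IsStationary.action_neg {V : EuclideanSpace ℝ (Fin d) → ℝ} {p ω : ℝ} (hp : 1 < p)
    {φ : EuclideanSpace ℝ (Fin d) → ℂ} (hφ : IsStationary V p ω φ) : action V p ω φ < 0 := by
  have h1 : firstVariation V p ω φ φ = 0 := hφ.2.2 φ hφ.1
  rw [firstVariation_self V hp, Complex.ofReal_eq_zero] at h1
  have h2 := hφ.1.powerIntegral_pos hp hφ.2.1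
  have h3 : 2 / (p + 1) < 1 := by rw [div_lt_one (by linarith)]; linarith
  rw [hφ.1.action_eq]
  nlinarith

/-- An action ground state minimizes the action over all functions of finite energy: the global
minimizer has negative action, so it is nonzero and hence one of the competitors. -/
theorem IsActionGroundState.action_le {V : EuclideanSpace ℝ (Fin d) → ℝ}
    (hVm : AEMeasurable V volume) (hV : ∀ x, 0 ≤ V x)
    (hVc : Tendsto V (cocompact (EuclideanSpace ℝ (Fin d))) atTop) {p : ℝ} (hp : 1 < p) {ω : ℝ}
    {φ χ : EuclideanSpace ℝ (Fin d) → ℂ} (hφ : IsActionGroundState V p ω φ)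
    (hχ : FiniteEnergy V p χ) : action V p ω φ ≤ action V p ω χ := by
  obtain ⟨ψ, hψ, hmin⟩ := exists_isMinOn_action hVm hV hVc hp ω ⟨φ, hφ.1.1⟩
  have hneg : action V p ω ψ < 0 := (hmin φ hφ.1.1).trans_lt (hφ.1.action_neg hp)
  have h0 : ¬ ψ =ᵐ[volume] 0 := by
    intro h
    have hM : mass ψ = 0 := by
      refine (integral_congr_ae ?_).trans (integral_zero _ _)
      filter_upwards [h] with x hx
      simp [hx]
    rw [hψ.action_eq, hM] at hneg
    have h1 : 0 ≤ 2 / (p + 1) * powerIntegral p ψ :=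
      mul_nonneg (by positivity) (powerIntegral_nonneg p ψ)
    linarith [dirichlet_nonneg ψ, potentialEnergy_nonneg hV ψ]
  exact (hφ.2 ψ ⟨hψ, h0, fun v hv => hψ.firstVariation_eq_zero hVm hV hp hmin hv⟩).trans
    (hmin χ hχ)

end DefocusingNLS

end

theorem theorem3p1 (d : ℕ) (hd : 1 ≤ d) (p : ℝ) (hp : 1 < p)
    (hp_sub : 3 ≤ d → p < ((d : ℝ) + 2) / ((d : ℝ) - 2))
    (V : EuclideanSpace ℝ (Fin d) → ℝ) (hV_meas : AEMeasurable V MeasureTheory.volume)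
    (hV_nonneg : ∀ x, 0 ≤ V x)
    (hV_conf : Filter.Tendsto V (Filter.cocompact (EuclideanSpace ℝ (Fin d))) Filter.atTop)
    (ω : ℝ) (hω : ω < -DefocusingNLS.omegaZero V)
    (φ : EuclideanSpace ℝ (Fin d) → ℂ) (hφ : DefocusingNLS.IsActionGroundState V p ω φ) :
    DefocusingNLS.IsEnergyGroundState V p (DefocusingNLS.mass φ) φ := by
  refine ⟨hφ.1.1.mass_pos hφ.1.2.1, hφ.1.1, rfl, fun ψ hψ hm => ?_⟩
  have h := hφ.action_le hV_meas hV_nonneg hV_conf hp hψ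
  rwa [DefocusingNLS.action, DefocusingNLS.action, hm, add_le_add_iff_right] at h
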